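/- Let $S^1=\mathbb R/\mathbb Z$, let $\pi:\mathbb R^2\to S^1\times\mathbb R$ and $p:\mathbb R^2\to\mathbb T^2=\mathbb R^2/\mathbb Z^2$ be the covering maps, and write points of the plane as $(\phi,I)$. Let $TQ$ be the set of $C^1$ diffeomorphisms $T=(T_\phi,T_I)$ of $\mathbb R^2$ that are lifts of $C^1$ diffeomorphisms of $S^1\times\mathbb R$, with $\partial_I T_\phi>0$ everywhere, with $T_\phi(\phi,I)\to\pm\infty$ and $T_I(\phi,I)\to\pm\infty$ as $I\to\pm\infty$, and with $$T_I(\phi+1,I)=T_I(\phi,I),\quad T_I(\phi,I+1)=T_I(\phi,I)+1,\quad T_\phi(\phi+1,I)=T_\phi(\phi,I)+1,\quad T_\phi(\phi,I+1)=T_\phi(\phi,I)+1 .$$ Such a $T$ induces a map $\widehat T$ of $S^1\times\mathbb R$ and a map $\overline T$ of $\mathbb T^2$. Let $\mu$ be a measure on $S^1\times\mathbb R$ that is positive on nonempty open sets and absolutely continuous with respect to Lebesgue measure. The map $\widehat T$ is called $\mu$-exact if $\mu$ is $\widehat T$-invariant and $\mu(\widehat T(A)\setminus A)=\mu(A\setminus\widehat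 T(A))$ for every open set $A\subset S^1\times\mathbb R$ that is homeomorphic to $S^1\times\mathbb R$, contains $S^1\times(-\infty,a)$ for some $a\in\mathbb R$, and is contained in $S^1\times(-\infty,b)$ for some $b\in\mathbb R$. A periodic orbit $O\subset\mathbb T^2$ of $\overline T$ has vertical rotation number $\omega$ if for every $z\in p^{-1}(O)$ the second coordinate $I_n$ of $T^n(z)$ tends to $+\infty$ or to $-\infty$ as $n\to\infty$ and $\lim_{n\to\infty}(I_n-I_0)/n=\omega$. **Theorem.** Let $T\in TQ$ be such that $\widehat T$ is $\mu$-exact for some such measure $\mu$. Let $k\in\mathbb Z$ and $N\ge 1$, and suppose that $\overline T$ has a periodic orbit with vertical rotation number $k/N$. Then for all integers $k'\neq 0$ and $N'\ge 1$ with $0<|k'/N'|<|k/N|$ and $kk'>0$, the map $\overline T$ has at least two distinct periodic orbits with vertical rotation number $k'/N'$. -/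

import Mathlib

open MeasureTheory Filter Topology

noncomputable section

namespace TwistMap

/-- The universal cover `ℝ²`, with coordinates `(φ, I)`. -/
abbrev Plane : Type := ℝ × ℝ

/-- The cylinder `S¹ × ℝ`, with `S¹ = ℝ/ℤ`. -/
abbrev Cylinder : Type := UnitAddCircle × ℝ

/-- The torus `ℝ²/ℤ²`. -/
abbrev Torus : Type := UnitAddCircle × UnitAddCircle

/-- The covering map of the cylinder, `(φ, I) ↦ (φ mod 1, I)`. -/
def toCylinder (z : Plane) : Cylinder := ((z.1 : UnitAddCircle), z.2)

/-- The covering map of the torus. -/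
def toTorus (z : Plane) : Torus := ((z.1 : UnitAddCircle), (z.2 : UnitAddCircle))

/-- `f` is a `C¹` diffeomorphism of the plane. -/
def IsC1Diffeo (f : Plane → Plane) : Prop :=
  ContDiff ℝ 1 f ∧ ∃ g : Plane → Plane,
    ContDiff ℝ 1 g ∧ Function.LeftInverse g f ∧ Function.RightInverse g f

/-- The class `D_r¹(ℝ²)` of lifts of right twist diffeomorphisms of the cylinder. -/
structure IsTwistLift (f : Plane → Plane) : Prop where
  diffeo : IsC1Diffeo f
  vert_top : ∀ φ : ℝ, Tendsto (fun I : ℝ => (f (φ, I)).2) atTop atTop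
  vert_bot : ∀ φ : ℝ, Tendsto (fun I : ℝ => (f (φ, I)).2) atBot atBot
  twist : ∀ φ I : ℝ, 0 < deriv (fun t : ℝ => (f (φ, t)).1) I
  horiz_top : ∀ φ : ℝ, Tendsto (fun I : ℝ => (f (φ, I)).1) atTop atTop
  horiz_bot : ∀ φ : ℝ, Tendsto (fun I : ℝ => (f (φ, I)).1) atBot atBot
  /-- `f` covers a bijection of the cylinder that is a homeomorphism; since `toCylinder` is a local
  diffeomorphism and `f` is a `C¹` diffeomorphism, the covered map is then a `C¹` diffeomorphism. -/
  lift : ∃ F : Cylinder ≃ₜ Cylinder, ∀ z : Plane, F (toCylinder z) = toCylinder (f z)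

/-- The class `TQ`. -/
structure IsTQ (T : Plane → Plane) : Prop extends IsTwistLift T where
  vert_add_fst : ∀ φ I : ℝ, (T (φ + 1, I)).2 = (T (φ, I)).2
  vert_add_snd : ∀ φ I : ℝ, (T (φ, I + 1)).2 = (T (φ, I)).2 + 1
  horiz_add_fst : ∀ φ I : ℝ, (T (φ + 1, I)).1 = (T (φ, I)).1 + 1
  horiz_add_snd : ∀ φ I : ℝ, (T (φ, I + 1)).1 = (T (φ, I)).1 + 1

/-- The representative in `[0, 1)` of a point of the circle. -/
def rep (x : UnitAddCircle) : ℝ := (AddCircle.equivIco 1 0 x : ℝ)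

/-- The map of the cylinder induced by `T`; see `IsTQ.cylinderMap_toCylinder`. -/
def cylinderMap (T : Plane → Plane) (x : Cylinder) : Cylinder := toCylinder (T (rep x.1, x.2))

/-- The map of the torus induced by `T`; see `IsTQ.torusMap_toTorus`. -/
def torusMap (T : Plane → Plane) (x : Torus) : Torus := toTorus (T (rep x.1, rep x.2))

theorem rep_coe (t : ℝ) : ∃ n : ℤ, rep (t : UnitAddCircle) = t + n := by
  have h : ((rep (t : UnitAddCircle) : ℝ) : UnitAddCircle) = (t : UnitAddCircle) :=
    AddCircle.coe_equivIco
  rw [← sub_eq_zero, ← AddCircle.coe_sub, AddCircle.coe_eq_zero_iff] at h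
  obtain ⟨n, hn⟩ := h
  refine ⟨n, ?_⟩
  simp at hn
  linarith

theorem IsTQ.apply_add_int {T : Plane → Plane} (hT : IsTQ T) (φ I : ℝ) (i j : ℤ) :
    T (φ + i, I + j) = ((T (φ, I)).1 + i + j, (T (φ, I)).2 + j) := by
  have h1 : ∀ (i : ℤ) (φ I : ℝ), T (φ + i, I) = ((T (φ, I)).1 + i, (T (φ, I)).2) := by
    intro i
    induction i using Int.induction_on with
    | zero => intro φ I; simp
    | succ n ih =>
      intro φ I
      have e : φ + ((n + 1 : ℤ) : ℝ) = (φ + (n : ℤ)) + 1 := by push_cast; ring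
      rw [e]
      ext
      · rw [hT.horiz_add_fst, ih]; push_cast; ring
      · rw [hT.vert_add_fst, ih]
    | pred n ih =>
      intro φ I
      have e : φ + ((-(n : ℤ) : ℤ) : ℝ) = (φ + ((-(n : ℤ) - 1 : ℤ) : ℝ)) + 1 := by
        push_cast; ring
      have h := ih φ I
      rw [e] at h
      ext
      · have := hT.horiz_add_fst (φ + ((-(n : ℤ) - 1 : ℤ) : ℝ)) I
        rw [h] at this; push_cast at this ⊢; linarith
      · have := hT.vert_add_fst (φ + ((-(n : ℤ) - 1 : ℤ) : ℝ)) I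
        rw [h] at this; exact this.symm
  have h2 : ∀ (j : ℤ) (φ I : ℝ), T (φ, I + j) = ((T (φ, I)).1 + j, (T (φ, I)).2 + j) := by
    intro j
    induction j using Int.induction_on with
    | zero => intro φ I; simp
    | succ n ih =>
      intro φ I
      have e : I + ((n + 1 : ℤ) : ℝ) = (I + (n : ℤ)) + 1 := by push_cast; ring
      rw [e]
      ext
      · rw [hT.horiz_add_snd, ih]; push_cast; ring
      · rw [hT.vert_add_snd, ih]; push_cast; ring
    | pred n ih =>
      intro φ I
      have e : I + ((-(n : ℤ) : ℤ) : ℝ) = (I + ((-(n : ℤ) - 1 : ℤ) : ℝ)) + 1 := by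
        push_cast; ring
      have h := ih φ I
      rw [e] at h
      ext
      · have := hT.horiz_add_snd φ (I + ((-(n : ℤ) - 1 : ℤ) : ℝ))
        rw [h] at this; push_cast at this ⊢; linarith
      · have := hT.vert_add_snd φ (I + ((-(n : ℤ) - 1 : ℤ) : ℝ))
        rw [h] at this; push_cast at this ⊢; linarith
  rw [h2, h1]

theorem coe_add_int (t : ℝ) (n : ℤ) : ((t + n : ℝ) : UnitAddCircle) = (t : UnitAddCircle) := by
  rw [← sub_eq_zero, ← AddCircle.coe_sub, AddCircle.coe_eq_zero_iff]
  exact ⟨n, by simp⟩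

theorem IsTQ.cylinderMap_toCylinder {T : Plane → Plane} (hT : IsTQ T) (z : Plane) :
    cylinderMap T (toCylinder z) = toCylinder (T z) := by
  obtain ⟨n, hn⟩ := rep_coe z.1
  have h := hT.apply_add_int z.1 z.2 n 0
  simp only [Int.cast_zero, add_zero] at h
  simp only [cylinderMap, toCylinder, hn, h, coe_add_int]

theorem IsTQ.torusMap_toTorus {T : Plane → Plane} (hT : IsTQ T) (z : Plane) :
    torusMap T (toTorus z) = toTorus (T z) := by
  obtain ⟨n, hn⟩ := rep_coe z.1
  obtain ⟨m, hm⟩ := rep_coe z.2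
  simp only [torusMap, toTorus, hn, hm, hT.apply_add_int, coe_add_int]

/-- `F` is `μ`-exact: `μ` is positive on open sets, absolutely continuous with respect to Lebesgue
measure and `F`-invariant, and the net `μ`-flux through every essential boundary vanishes. The sets
`A` are the open sets homeomorphic to the cylinder that are a neighbourhood of the lower end and
are bounded above. -/
structure IsExact (μ : Measure Cylinder) (F : Cylinder → Cylinder) : Prop where
  pos : ∀ U : Set Cylinder, IsOpen U → U.Nonempty → 0 < μ U
  ac : μ ≪ volume
  invariant : MeasurePreserving F μ μ
  flux : ∀ A : Set Cylinder, IsOpen A → Nonempty (A ≃ₜ Cylinder) →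
    (∃ a b : ℝ, (∀ x : Cylinder, x.2 < a → x ∈ A) ∧ (∀ x ∈ A, x.2 < b)) →
    μ ((F '' A) \ A) = μ (A \ (F '' A))

/-- `O` is the orbit of a periodic point of `F`. -/
def IsPeriodicOrbit {X : Type*} (F : X → X) (O : Set X) : Prop :=
  ∃ x : X, (∃ n : ℕ, 0 < n ∧ F^[n] x = x) ∧ O = Set.range (fun m : ℕ => F^[m] x)

/-- The set `O` of points of the torus has vertical rotation number `ω`: the lifted orbits of its
points go up or down to infinity, with asymptotic vertical speed `ω`. -/
def HasVerticalRotationNumber (T : Plane → Plane) (O : Set Torus) (ω : ℝ) : Prop :=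
  ∀ z : Plane, toTorus z ∈ O →
    (Tendsto (fun n : ℕ => (T^[n] z).2) atTop atTop ∨
      Tendsto (fun n : ℕ => (T^[n] z).2) atTop atBot) ∧
    Tendsto (fun n : ℕ => ((T^[n] z).2 - z.2) / (n : ℝ)) atTop (𝓝 ω)

end TwistMap

end

/-! Because of the twist, an orbit of `T` is determined by its first coordinates `x i`, which solve
`g (x i) (x (i + 1)) = h (x (i - 1)) (x i)` with `g` increasing in its second argument and `h`
decreasing in its first (`IsTQ.exists_isGeneratingPair`). If `T^[n] z = z + (a, b)`, then `x (i + n)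
= x i + a + b * i`: vertical speed becomes quadratic growth. Subtracting an integer sequence whose
second difference is `k'` once every `N'` steps gives a solution of a recurrence with `N'`-periodic
forcing, and `N'`-periodic solutions of the latter are points with `T^[N'] z = z + (0, k')`. The
subtracted sequence tends to `+∞` at both ends if the speed of the orbit exceeds `k'/N'`, and to
`-∞` if it is smaller. Minima over residue classes then give a strict periodic supersolution, maxima
a strict subsolution (`exists_strict_super`, `exists_strict_sub`).

The two orbits needed are the given one and a fixed point, of speed zero. Exactness supplies the
fixed point (`IsExact.exists_diag_eq`): without it a curve around the cylinder and its image would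
be disjoint and the flux between them nonzero.

A small relaxation step of the recurrence is a strongly monotone map commuting with integer
translations. A translate of the subsolution lies below the supersolution, so monotone iteration
gives one fixed point. If all fixed points were translates of it, Brouwer's theorem would still
produce one on the boundary of the basin below the supersolution, where no translate can lie
(`exists_two_fixedPoints`). In lowest terms, solutions that are not translates of each other give
distinct orbits on the torus. -/

/-! ### Brouwer's fixed point theorem, by change of variables and polynomial extrapolation. -/

section Brouwer

open Polynomial in
/-- A real polynomial of degree at most `d` satisfies a fixed extrapolation formula, with weights of
sum one, from nodes in any interval `[0, δ]`. -/
theorem exists_extrapolation_weights (d : ℕ) {δ : ℝ} (hδ : 0 < δ) :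
    ∃ (v w : ℕ → ℝ), (∀ j ∈ Finset.range (d + 1), v j ∈ Set.Icc 0 δ) ∧
      ∑ j ∈ Finset.range (d + 1), w j = 1 ∧
      ∀ p : ℝ[X], p.natDegree ≤ d →
        p.eval 1 = ∑ j ∈ Finset.range (d + 1), w j * p.eval (v j) := by
  set v : ℕ → ℝ := fun j => δ * j / (d + 1) with hv
  have hinj : Set.InjOn v (Finset.range (d + 1) : Set ℕ) := by
    intro a _ b _ hab
    have h1 : (d + 1 : ℝ) ≠ 0 := by positivity
    simp only [hv] at hab
    field_simp at hab
    exact_mod_cast hab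
  have key : ∀ p : ℝ[X], p.natDegree ≤ d → p.eval 1 = ∑ j ∈ Finset.range (d + 1),
      (Lagrange.basis (Finset.range (d + 1)) v j).eval 1 * p.eval (v j) := by
    intro p hp
    have hdeg : p.degree < (Finset.range (d + 1)).card := by
      rw [Finset.card_range]
      exact lt_of_le_of_lt (degree_le_of_natDegree_le hp) (by exact_mod_cast Nat.lt_succ_self d)
    have h := Lagrange.eq_interpolate hinj hdeg
    conv_lhs => rw [h, Lagrange.interpolate_apply, eval_finsetSum]
    refine Finset.sum_congr rfl fun j _ => ?_
    rw [eval_mul, eval_C, mul_comm]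
  refine ⟨v, fun j => (Lagrange.basis (Finset.range (d + 1)) v j).eval 1, ?_, ?_, key⟩
  · intro j hj
    have hj' : (j : ℝ) ≤ d + 1 := by
      have := Finset.mem_range.1 hj
      exact_mod_cast this.le
    refine ⟨by simp only [hv]; positivity, ?_⟩
    simp only [hv]
    rw [div_le_iff₀ (by positivity)]
    gcongr
  · have h := key 1 (by simp)
    simpa using h.symm

variable {ι : Type*} [Fintype ι]

/-- Small multiples of a compactly supported perturbation of the identity preserve integrals over a
ball containing the support. -/
theorem exists_integral_perturbation_eq {g : (ι → ℝ) → (ι → ℝ)} (hg : ContDiff ℝ 1 g)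
    (hc : HasCompactSupport g) {R : ℝ} (hR : ∀ x, x ∉ Metric.closedBall (0 : ι → ℝ) R → g x = 0) :
    ∃ δ > 0, ∀ t ∈ Set.Icc (0 : ℝ) δ, ∀ ω : (ι → ℝ) → ℝ,
      ∫ x in Metric.closedBall (0 : ι → ℝ) R,
        (ContinuousLinearMap.id ℝ (ι → ℝ) + t • fderiv ℝ g x).det * ω (x + t • g x) =
      ∫ x in Metric.closedBall (0 : ι → ℝ) R, ω x := by
  obtain ⟨K, hK⟩ := hg.lipschitzWith_of_hasCompactSupport hc one_ne_zero
  have hpos : ∀ᶠ A in 𝓝 (ContinuousLinearMap.id ℝ (ι → ℝ)), 0 < A.det := by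
    refine (ContinuousLinearMap.continuous_det (E := ι → ℝ) (𝕜 := ℝ)).continuousAt.eventually
      (lt_mem_nhds ?_)
    simp [ContinuousLinearMap.det]
  obtain ⟨η, hη, hdet⟩ := Metric.eventually_nhds_iff.1 hpos
  -- This makes `t * K < 1`, so that `x + t • g x = y` is solved by contraction, and `t * K < η`, so
  -- that the Jacobian is positive.
  refine ⟨min 1 η / (2 * (K + 1)), by positivity, fun t ht ω => ?_⟩
  have ht0 := ht.1
  have htK : t * K < min 1 η := by
    have h1 : t * (2 * (K + 1)) ≤ min 1 η := (le_div_iff₀ (by positivity)).1 ht.2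
    have h2 : 0 < min 1 η := by positivity
    have h3 : 0 ≤ (K : ℝ) := K.2
    nlinarith
  have hdt : ∀ x, 0 < (ContinuousLinearMap.id ℝ (ι → ℝ) + t • fderiv ℝ g x).det := by
    intro x
    apply hdet
    rw [dist_eq_norm, add_sub_cancel_left, norm_smul, Real.norm_of_nonneg ht0]
    exact ((mul_le_mul_of_nonneg_left (norm_fderiv_le_of_lipschitz ℝ hK) ht0).trans_lt htK).trans_le
      (min_le_right _ _)
  have hcontr : ∀ y, ContractingWith (Real.toNNReal (t * K)) (fun x => y - t • g x) := by
    intro y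
    refine ⟨by rw [Real.toNNReal_lt_one]; exact htK.trans_le (min_le_left _ _), ?_⟩
    refine LipschitzWith.of_dist_le_mul fun a b => ?_
    have hc : ((Real.toNNReal (t * K) : NNReal) : ℝ) = t * K :=
      Real.coe_toNNReal _ (mul_nonneg ht0 K.2)
    rw [dist_sub_left, dist_smul₀, Real.norm_of_nonneg ht0, hc, mul_assoc]
    exact mul_le_mul_of_nonneg_left (hK.dist_le_mul a b) ht0
  have hinj : Function.Injective fun x => x + t • g x := by
    intro a b hab
    have hab' : a + t • g a = b + t • g b := hab
    have h1 : Function.IsFixedPt (fun x => (a + t • g a) - t • g x) a := by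
      simp [Function.IsFixedPt]
    have h2 : Function.IsFixedPt (fun x => (a + t • g a) - t • g x) b := by
      simp [Function.IsFixedPt, hab']
    exact (hcontr _).fixedPoint_unique' h1 h2
  have hsurj : Function.Surjective fun x => x + t • g x := by
    intro y
    have h := (hcontr y).fixedPoint_isFixedPt
    refine ⟨ContractingWith.fixedPoint _ (hcontr y), ?_⟩
    have h' : y - t • g (ContractingWith.fixedPoint _ (hcontr y)) = _ := h
    simp only
    conv_lhs => enter [1]; rw [← h']
    simp
  -- A bijection that fixes every point outside the ball preserves the ball.
  have himage : (fun x => x + t • g x) '' Metric.closedBall (0 : ι → ℝ) R =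
      Metric.closedBall (0 : ι → ℝ) R := by
    apply Set.Subset.antisymm
    · rintro _ ⟨x, hx, rfl⟩
      by_contra hy
      simp only at hy
      have h1 := hR _ hy
      have h2 : x + t • g x = x := hinj (by simp [h1])
      rw [h2] at hy
      exact hy hx
    · intro y hy
      obtain ⟨x, rfl⟩ := hsurj y
      refine ⟨x, ?_, rfl⟩
      by_contra hx
      simp only [hR x hx, smul_zero, add_zero] at hy
      exact hx hy
  have hcv := integral_image_eq_integral_abs_det_fderiv_smul volume
    (s := Metric.closedBall (0 : ι → ℝ) R) (f := fun x => x + t • g x)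
    (f' := fun x => ContinuousLinearMap.id ℝ (ι → ℝ) + t • fderiv ℝ g x)
    Metric.isClosed_closedBall.measurableSet
    (fun x _ => ((hasFDerivAt_id x).add
      ((hg.differentiable one_ne_zero x).hasFDerivAt.const_smul t)).hasFDerivWithinAt)
    hinj.injOn ω
  rw [himage] at hcv
  rw [hcv]
  refine integral_congr_ae (Eventually.of_forall fun x => ?_)
  simp only [smul_eq_mul, abs_of_pos (hdt x)]

open Polynomial in
/-- Along the homotopy `x + t • v`, a power of a quadratic times the Jacobian of `1 + t • A` is a
polynomial in `t` of bounded degree. -/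
theorem exists_polynomial_quadratic_pow_mul_det [DecidableEq ι] (S : ℝ) (m : ℕ) (x v : ι → ℝ)
    (A : (ι → ℝ) →L[ℝ] (ι → ℝ)) :
    ∃ p : ℝ[X], p.natDegree ≤ Fintype.card ι + 2 * m ∧ ∀ t : ℝ, p.eval t =
      (ContinuousLinearMap.id ℝ (ι → ℝ) + t • A).det * (1 - (∑ i, (x + t • v) i ^ 2) / S) ^ m := by
  refine ⟨Matrix.det ((X : ℝ[X]) • (LinearMap.toMatrix' A.toLinearMap).map C +
    (1 : Matrix ι ι ℝ).map C) * (1 - C S⁻¹ * ∑ i, (C (x i) + X * C (v i)) ^ 2) ^ m, ?_, ?_⟩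
  · refine natDegree_mul_le.trans (add_le_add (natDegree_det_X_add_C_le _ _) ?_)
    refine natDegree_pow_le.trans ?_
    rw [mul_comm]
    refine Nat.mul_le_mul_right _ ?_
    refine (natDegree_sub_le _ _).trans (max_le (by simp) ?_)
    refine natDegree_mul_le.trans ?_
    rw [natDegree_C, zero_add]
    refine natDegree_sum_le_of_forall_le _ _ fun i _ => ?_
    refine natDegree_pow_le.trans ?_
    have : (C (x i) + X * C (v i) : ℝ[X]).natDegree ≤ 1 := by
      refine (natDegree_add_le _ _).trans (max_le (by simp) ?_)
      exact natDegree_mul_le.trans (by simp)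
    omega
  · intro t
    have h1 : (ContinuousLinearMap.id ℝ (ι → ℝ) + t • A).det = eval t (Matrix.det
        ((X : ℝ[X]) • (LinearMap.toMatrix' A.toLinearMap).map C + (1 : Matrix ι ι ℝ).map C)) := by
      rw [← coe_evalRingHom, RingHom.map_det, ContinuousLinearMap.det, ← LinearMap.det_toMatrix']
      congr 1
      ext i j
      have h2 : LinearMap.toMatrix' (LinearMap.id : (ι → ℝ) →ₗ[ℝ] ι → ℝ) i j =
          (1 : Matrix ι ι ℝ) i j := by rw [LinearMap.toMatrix'_id]
      simp only [ContinuousLinearMap.toLinearMap_add, ContinuousLinearMap.coe_id, map_add,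
        ContinuousLinearMap.toLinearMap_smul, map_smul, Matrix.add_apply, Matrix.smul_apply, h2,
        RingHom.mapMatrix_apply, Matrix.map_apply, coe_evalRingHom, smul_eq_mul,
        eval_mul, eval_X, eval_C]
      ring
    rw [eval_mul, h1]
    congr 1
    simp only [eval_pow, eval_sub, eval_one, eval_mul, eval_C, eval_finsetSum, eval_add, eval_X,
      Pi.add_apply, Pi.smul_apply, smul_eq_mul]
    rw [div_eq_inv_mul]

/-- A `C¹` perturbation of the identity with compact support takes the value zero. -/
theorem exists_add_eq_zero_of_hasCompactSupport {g : (ι → ℝ) → (ι → ℝ)} (hg : ContDiff ℝ 1 g)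
    (hc : HasCompactSupport g) : ∃ x, x + g x = 0 := by
  classical
  -- The change of variables formula for `(1 - q / S) ^ (2 * m)` is polynomial in `t`, so it extends
  -- from small `t` to `t = 1`. If `x + g x` never vanishes, the transformed side is at most `C * a
  -- ^ (2 * m)`, while the mass near the origin keeps the other above `V * b ^ (2 * m)` with `b >
  -- a`; this fails for large `m`.
  by_contra! hne
  obtain ⟨R, hR1, hR⟩ : ∃ R : ℝ, 1 ≤ R ∧ ∀ x, x ∉ Metric.closedBall (0 : ι → ℝ) R → g x = 0 := by
    obtain ⟨R, hR⟩ := hc.isBounded.subset_closedBall (0 : ι → ℝ)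
    refine ⟨max R 1, le_max_right _ _, fun x hx => image_eq_zero_of_notMem_tsupport fun h => hx ?_⟩
    exact Metric.closedBall_subset_closedBall (le_max_left _ _) (hR h)
  set B := Metric.closedBall (0 : ι → ℝ) R with hB
  have hBc : IsCompact B := isCompact_closedBall _ _
  have hB0 : (0 : ι → ℝ) ∈ B := Metric.mem_closedBall_self (by linarith)
  have hgc : Continuous g := hg.continuous
  set q : (ι → ℝ) → ℝ := fun y => ∑ i, y i ^ 2 with hq
  have hqc : Continuous q := by fun_prop
  have hq0 : ∀ y, 0 ≤ q y := fun y => Finset.sum_nonneg fun i _ => sq_nonneg _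
  have hqpos : ∀ y, y ≠ 0 → 0 < q y := by
    intro y hy
    refine lt_of_le_of_ne (hq0 y) fun h => hy ?_
    have h2 := (Finset.sum_eq_zero_iff_of_nonneg fun i _ => sq_nonneg (y i)).1 h.symm
    ext i
    simpa using h2 i (Finset.mem_univ i)
  have hfc : Continuous fun x => q (x + g x) := hqc.comp (by fun_prop)
  obtain ⟨x₀, -, hx₀⟩ := hBc.exists_isMinOn ⟨0, hB0⟩ hfc.continuousOn
  obtain ⟨x₁, -, hx₁⟩ := hBc.exists_isMaxOn ⟨0, hB0⟩ hfc.continuousOn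
  set η := q (x₀ + g x₀) with hη
  have hηpos : 0 < η := hqpos _ (hne x₀)
  set S := q (x₁ + g x₁) with hS
  have hηS : η ≤ S := (hx₀ hB0).trans (hx₁ hB0)
  have hSpos : 0 < S := hηpos.trans_le hηS
  -- sufficiently close to the origin the quadratic form is small
  obtain ⟨r, hr, hrB, hrq⟩ : ∃ r > 0, Metric.closedBall (0 : ι → ℝ) r ⊆ B ∧
      ∀ x ∈ Metric.closedBall (0 : ι → ℝ) r, q x ≤ η / 2 := by
    have h1 : ∀ᶠ x in 𝓝 (0 : ι → ℝ), q x < η / 2 := by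
      refine hqc.continuousAt.eventually (gt_mem_nhds ?_)
      simp [hq, hηpos]
    obtain ⟨ε, hε, h2⟩ := Metric.eventually_nhds_iff.1 h1
    refine ⟨min (ε / 2) R, by positivity, Metric.closedBall_subset_closedBall (min_le_right _ _),
      fun x hx => (h2 ?_).le⟩
    have := (Metric.mem_closedBall.1 hx).trans (min_le_left _ _)
    linarith
  set J : (ι → ℝ) → ℝ := fun x => (ContinuousLinearMap.id ℝ (ι → ℝ) + fderiv ℝ g x).det with hJ
  have hdc : Continuous (fderiv ℝ g) := hg.continuous_fderiv one_ne_zero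
  have hJc : Continuous J := ContinuousLinearMap.continuous_det.comp (by fun_prop)
  obtain ⟨δ, hδ, hcv⟩ := exists_integral_perturbation_eq hg hc hR
  -- the change of variables formula persists at the end of the homotopy
  have main : ∀ m : ℕ, ∫ x in B, J x * (1 - q (x + g x) / S) ^ (2 * m) =
      ∫ x in B, (1 - q x / S) ^ (2 * m) := by
    intro m
    obtain ⟨v, w, hv, hw, hvw⟩ := exists_extrapolation_weights (Fintype.card ι + 2 * (2 * m)) hδ
    have hpt : ∀ x, J x * (1 - q (x + g x) / S) ^ (2 * m) =
        ∑ j ∈ Finset.range (Fintype.card ι + 2 * (2 * m) + 1), w j *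
          ((ContinuousLinearMap.id ℝ (ι → ℝ) + v j • fderiv ℝ g x).det *
            (1 - q (x + v j • g x) / S) ^ (2 * m)) := by
      intro x
      obtain ⟨p, hp, hpe⟩ := exists_polynomial_quadratic_pow_mul_det S (2 * m) x (g x)
        (fderiv ℝ g x)
      have h := hvw p hp
      simp only [hpe, one_smul] at h
      exact h
    simp_rw [hpt]
    rw [integral_finsetSum]
    · calc _ = ∑ j ∈ Finset.range (Fintype.card ι + 2 * (2 * m) + 1),
          w j * ∫ x in B, (1 - q x / S) ^ (2 * m) := by
            refine Finset.sum_congr rfl fun j hj => ?_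
            rw [integral_const_mul]
            congr 1
            exact hcv (v j) (hv j hj) fun y => (1 - q y / S) ^ (2 * m)
        _ = _ := by rw [← Finset.sum_mul, hw, one_mul]
    · intro j _
      refine (Continuous.continuousOn ?_).integrableOn_compact hBc
      refine continuous_const.mul ((ContinuousLinearMap.continuous_det.comp (by fun_prop)).mul ?_)
      have : Continuous fun x => q (x + v j • g x) := hqc.comp (by fun_prop)
      fun_prop
  set a := 1 - η / S with ha
  set b := 1 - η / 2 / S with hb
  have ha0 : 0 ≤ a := by
    have : η / S ≤ 1 := (div_le_one hSpos).2 hηS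
    linarith
  have hab : a < b := by
    have : η / 2 / S < η / S := by gcongr; linarith
    linarith
  set V := (volume (Metric.closedBall (0 : ι → ℝ) r)).toReal with hV
  have hVpos : 0 < V := ENNReal.toReal_pos (Metric.measure_closedBall_pos _ _ hr).ne'
    measure_closedBall_lt_top.ne
  set C := ∫ x in B, |J x| with hC
  have hupper : ∀ m : ℕ, ∫ x in B, J x * (1 - q (x + g x) / S) ^ (2 * m) ≤ C * a ^ (2 * m) := by
    intro m
    rw [hC, ← integral_mul_const]
    refine setIntegral_mono_on ?_ ?_ hBc.measurableSet ?_
    · exact (Continuous.continuousOn (by fun_prop)).integrableOn_compact hBc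
    · exact (Continuous.continuousOn (by fun_prop)).integrableOn_compact hBc
    · intro x hx
      have h1 : η ≤ q (x + g x) := hx₀ hx
      have h2 : q (x + g x) ≤ S := hx₁ hx
      have h3 : 0 ≤ 1 - q (x + g x) / S := by
        have : q (x + g x) / S ≤ 1 := (div_le_one hSpos).2 h2
        linarith
      have h4 : 1 - q (x + g x) / S ≤ a := by
        have : η / S ≤ q (x + g x) / S := by gcongr
        linarith
      exact mul_le_mul (le_abs_self _) (pow_le_pow_left₀ h3 h4 _) (pow_nonneg h3 _) (abs_nonneg _)
  -- The exponent is even because `q x` may exceed `S` on `B`; the part of the integral outside the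
  -- small ball is then still nonnegative.
  have hlower : ∀ m : ℕ, V * b ^ (2 * m) ≤ ∫ x in B, (1 - q x / S) ^ (2 * m) := by
    intro m
    have hint : IntegrableOn (fun x => (1 - q x / S) ^ (2 * m)) B :=
      (Continuous.continuousOn (by fun_prop)).integrableOn_compact hBc
    calc V * b ^ (2 * m) = ∫ x in Metric.closedBall (0 : ι → ℝ) r, b ^ (2 * m) := by
          simp [hV, Measure.real]
      _ ≤ ∫ x in Metric.closedBall (0 : ι → ℝ) r, (1 - q x / S) ^ (2 * m) := by
          refine setIntegral_mono_on ?_ (hint.mono_set hrB)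
            Metric.isClosed_closedBall.measurableSet ?_
          · exact integrableOn_const measure_closedBall_lt_top.ne
          · intro x hx
            refine pow_le_pow_left₀ (ha0.trans hab.le) ?_ _
            have : q x / S ≤ η / 2 / S := by gcongr; exact hrq x hx
            linarith
      _ ≤ _ := setIntegral_mono_set hint
          (Eventually.of_forall fun x => (even_two_mul m).pow_nonneg _) hrB.eventuallyLE
  have hb0 : 0 < b := ha0.trans_lt hab
  have hlim : Tendsto (fun m : ℕ => C * ((a / b) ^ 2) ^ m) atTop (𝓝 (C * 0)) := by
    refine (tendsto_pow_atTop_nhds_zero_of_lt_one (by positivity) ?_).const_mul C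
    have : a / b < 1 := (div_lt_one hb0).2 hab
    have h0 : 0 ≤ a / b := by positivity
    nlinarith
  rw [mul_zero] at hlim
  have hle : V ≤ 0 := by
    refine ge_of_tendsto' hlim fun m => ?_
    have h := (hlower m).trans ((main m).symm.le.trans (hupper m))
    rw [← pow_mul, div_pow, ← mul_div_assoc, le_div_iff₀ (by positivity)]
    exact h
  exact absurd hle (not_le.2 hVpos)

/-- **Brouwer's fixed point theorem** for an order interval of `ι → ℝ`. -/
theorem exists_fixedPoint_of_mapsTo_Icc {l h : ι → ℝ} (hlh : l ≤ h) {f : (ι → ℝ) → (ι → ℝ)}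
    (hf : ContinuousOn f (Set.Icc l h)) (hmaps : Set.MapsTo f (Set.Icc l h) (Set.Icc l h)) :
    ∃ x ∈ Set.Icc l h, f x = x := by
  set clamp : (ι → ℝ) → (ι → ℝ) := fun x => (x ⊔ l) ⊓ h with hclamp
  have hcl : ∀ x, clamp x ∈ Set.Icc l h := fun x => ⟨le_inf le_sup_right hlh, inf_le_right⟩
  have hcid : ∀ x ∈ Set.Icc l h, clamp x = x := fun x hx => by
    simp only [hclamp, sup_eq_left.2 hx.1, inf_eq_left.2 hx.2]
  have hlip : LipschitzWith 1 clamp := by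
    refine LipschitzWith.of_dist_le_mul fun a b => ?_
    rw [NNReal.coe_one, one_mul]
    refine (dist_pi_le_iff dist_nonneg).2 fun i => ?_
    refine le_trans ?_ (dist_le_pi_dist a b i)
    simp only [hclamp, Pi.inf_apply, Pi.sup_apply, Real.dist_eq]
    exact (abs_inf_sub_inf_le_abs _ _ _).trans (abs_sup_sub_sup_le_abs _ _ _)
  have hcompact : IsCompact (Set.Icc l h) := isCompact_Icc
  have huc : UniformContinuous fun x => f (clamp x) := by
    have h1 : UniformContinuousOn f (Set.Icc l h) := hcompact.uniformContinuousOn_of_continuous hf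
    rw [Metric.uniformContinuous_iff]
    intro ε hε
    obtain ⟨δ, hδ, h2⟩ := Metric.uniformContinuousOn_iff.1 h1 ε hε
    refine ⟨δ, hδ, fun {a b} hab => h2 _ (hcl a) _ (hcl b) ?_⟩
    exact ((hlip.dist_le_mul a b).trans (by simp)).trans_lt hab
  obtain ⟨R, hR⟩ := hcompact.isBounded.subset_closedBall (0 : ι → ℝ)
  have hRn : ∀ x, ‖f (clamp x)‖ ≤ |R| := fun x => by
    have := hR (hmaps (hcl x))
    rw [mem_closedBall_zero_iff] at this
    exact this.trans (le_abs_self R)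
  -- approximate fixed points
  have happrox : ∀ n : ℕ, ∃ x, dist (f (clamp x)) x ≤ 1 / (n + 1 : ℝ) := by
    intro n
    have hε : 0 < 1 / (n + 1 : ℝ) := by positivity
    obtain ⟨p, hp, hpd⟩ := huc.exists_contDiff_dist_le hε
    have hε1 : 1 / (n + 1 : ℝ) ≤ 1 := by
      rw [div_le_one (by positivity)]
      linarith [(Nat.cast_nonneg n : (0 : ℝ) ≤ n)]
    have hpn : ∀ x, ‖p x‖ ≤ |R| + 1 := fun x => by
      have h1 := norm_le_norm_add_norm_sub' (p x) (f (clamp x))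
      have h2 := hpd x
      rw [dist_eq_norm] at h2
      linarith [hRn x]
    -- The cutoff is `1` on a ball containing all values of `p`. A solution of `x = χ x • p x` lies
    -- in that ball and is therefore a fixed point of `p`.
    let χ : ContDiffBump (0 : ι → ℝ) :=
      ⟨|R| + 1, |R| + 2, by positivity, by linarith⟩
    have hχ : ContDiff ℝ 1 fun x => χ x := χ.contDiff
    obtain ⟨x, hx⟩ := exists_add_eq_zero_of_hasCompactSupport (g := fun x => -(χ x • p x))
      ((hχ.smul (hp.of_le (by exact_mod_cast le_top))).neg) (χ.hasCompactSupport.smul_right.neg)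
    rw [add_neg_eq_zero] at hx
    have hxn : ‖x‖ ≤ |R| + 1 := by
      rw [hx, norm_smul, Real.norm_of_nonneg χ.nonneg]
      calc χ x * ‖p x‖ ≤ 1 * (|R| + 1) :=
            mul_le_mul χ.le_one (hpn x) (norm_nonneg _) zero_le_one
        _ = _ := one_mul _
    have h1 : χ x = 1 := χ.one_of_mem_closedBall (by simpa using hxn)
    rw [h1, one_smul] at hx
    refine ⟨x, ?_⟩
    have h2 := (hpd x).le
    rw [← hx, dist_comm] at h2
    exact h2
  choose x hx using happrox
  have hbdd : ∀ n, x n ∈ Metric.closedBall (0 : ι → ℝ) (|R| + 1) := by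
    intro n
    rw [mem_closedBall_zero_iff]
    have h1 := norm_le_norm_add_norm_sub' (x n) (f (clamp (x n)))
    have h2 := hx n
    rw [dist_comm, dist_eq_norm] at h2
    have h3 : 1 / (n + 1 : ℝ) ≤ 1 := by
      rw [div_le_one (by positivity)]
      linarith [(Nat.cast_nonneg n : (0 : ℝ) ≤ n)]
    linarith [hRn (x n)]
  obtain ⟨y, -, s, hs, hy⟩ := (isCompact_closedBall (0 : ι → ℝ) (|R| + 1)).tendsto_subseq hbdd
  have hfy : f (clamp y) = y := by
    have h1 : Tendsto (fun n => dist (f (clamp (x (s n)))) (x (s n))) atTop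
        (𝓝 (dist (f (clamp y)) y)) :=
      ((huc.continuous.tendsto y).comp hy).dist hy
    have h2 : Tendsto (fun n => 1 / ((s n : ℝ) + 1)) atTop (𝓝 0) :=
      tendsto_one_div_add_atTop_nhds_zero_nat.comp hs.tendsto_atTop
    exact dist_le_zero.1 (le_of_tendsto_of_tendsto' h1 h2 fun n => hx (s n))
  have hyI : y ∈ Set.Icc l h := hfy ▸ hmaps (hcl y)
  exact ⟨y, hyI, by rw [hcid y hyI] at hfy; exact hfy⟩

end Brouwer

/-! ### Fixed points of strongly monotone maps. -/

section MonotoneMaps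

variable {ι : Type*}

/-- A monotone map has a fixed point between a subsolution and a supersolution. -/
theorem exists_fixedPoint_of_sub_super {P : (ι → ℝ) → (ι → ℝ)} (hc : Continuous P)
    (hmono : Monotone P) {l h : ι → ℝ} (hlh : l ≤ h) (hl : l ≤ P l) (hh : P h ≤ h) :
    ∃ u, P u = u ∧ l ≤ u ∧ u ≤ h := by
  have hanti : Antitone fun n => P^[n] h := hmono.antitone_iterate_of_map_le hh
  have hlow : ∀ n, l ≤ P^[n] h := by
    intro n
    exact (hmono.monotone_iterate_of_le_map hl (Nat.zero_le n)).trans (hmono.iterate n hlh)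
  have hlim : Tendsto (fun n => P^[n] h) atTop (𝓝 fun i => ⨅ n, P^[n] h i) := by
    refine tendsto_pi_nhds.2 fun i => tendsto_atTop_ciInf (fun a b hab => hanti hab i) ?_
    exact ⟨l i, by rintro _ ⟨n, rfl⟩; exact hlow n i⟩
  refine ⟨_, isFixedPt_of_tendsto_iterate hlim hc.continuousAt, ?_, ?_⟩
  · exact ge_of_tendsto' hlim hlow
  · exact le_of_tendsto' hlim fun n => hanti (Nat.zero_le n)

theorem exists_nat_forall_lt_add [Finite ι] (u v : ι → ℝ) : ∃ m : ℕ, ∀ i, u i < v i + m := by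
  cases nonempty_fintype ι
  obtain ⟨M, hM⟩ := (Set.finite_range fun i => u i - v i).bddAbove
  obtain ⟨m, hm⟩ := exists_nat_gt M
  refine ⟨m, fun i => ?_⟩
  have := hM ⟨i, rfl⟩
  simp only at this
  linarith

/-- The points strictly below `h` after finitely many steps. -/
def eventuallyBelow (P : (ι → ℝ) → (ι → ℝ)) (h : ι → ℝ) : Set (ι → ℝ) :=
  {u | ∃ n : ℕ, ∀ i, P^[n] u i < h i}

section Basin

variable {P : (ι → ℝ) → (ι → ℝ)} {h : ι → ℝ}

theorem isOpen_eventuallyBelow [Finite ι] (hc : Continuous P) : IsOpen (eventuallyBelow P h) := by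
  have : eventuallyBelow P h = ⋃ n : ℕ, ⋂ i, {u | P^[n] u i < h i} := by
    ext u; simp [eventuallyBelow]
  rw [this]
  refine isOpen_iUnion fun n => isOpen_iInter_of_finite fun i => ?_
  exact isOpen_lt ((continuous_apply i).comp (hc.iterate n)) continuous_const

theorem mem_eventuallyBelow_of_le (hmono : Monotone P) {u v : ι → ℝ} (huv : u ≤ v)
    (hv : v ∈ eventuallyBelow P h) : u ∈ eventuallyBelow P h := by
  obtain ⟨n, hn⟩ := hv
  exact ⟨n, fun i => (hmono.iterate n huv i).trans_lt (hn i)⟩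

/-- Being strictly below a supersolution persists: one more step lands strictly below `P h ≤ h`. -/
theorem apply_mem_eventuallyBelow_iff (hstrict : ∀ u v, (∀ i, u i < v i) → ∀ i, P u i < P v i)
    (hh : P h ≤ h) {u : ι → ℝ} : P u ∈ eventuallyBelow P h ↔ u ∈ eventuallyBelow P h := by
  constructor
  · rintro ⟨n, hn⟩
    exact ⟨n + 1, hn⟩
  · rintro ⟨n, hn⟩
    refine ⟨n, fun i => ?_⟩
    rw [← Function.iterate_succ_apply, Function.iterate_succ_apply']
    exact (hstrict _ _ hn i).trans_le (hh i)

theorem apply_mem_frontier_eventuallyBelow [Finite ι] (hc : Continuous P)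
    (hstrict : ∀ u v, (∀ i, u i < v i) → ∀ i, P u i < P v i)
    (hh : P h ≤ h) {u : ι → ℝ} (hu : u ∈ frontier (eventuallyBelow P h)) :
    P u ∈ frontier (eventuallyBelow P h) := by
  rw [(isOpen_eventuallyBelow hc).frontier_eq] at hu ⊢
  refine ⟨?_, fun h' => hu.2 ((apply_mem_eventuallyBelow_iff hstrict hh).1 h')⟩
  refine map_mem_closure hc hu.1 fun a ha => ?_
  exact (apply_mem_eventuallyBelow_iff hstrict hh).2 ha

/-- The boundary of the basin of a strongly monotone map contains no two comparable points. -/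
theorem eq_of_le_of_mem_frontier_eventuallyBelow [Finite ι] (hc : Continuous P) (hmono : Monotone P)
    (hstrict : ∀ u v, (∀ i, u i < v i) → ∀ i, P u i < P v i)
    {n : ℕ} (hstrong : ∀ u v, u < v → ∀ i, P^[n] u i < P^[n] v i) (hh : P h ≤ h)
    {u v : ι → ℝ} (hu : u ∈ frontier (eventuallyBelow P h))
    (hv : v ∈ frontier (eventuallyBelow P h)) (huv : u ≤ v) : u = v := by
  by_contra hne
  have hiter : ∀ (m : ℕ) (w : ι → ℝ), w ∈ frontier (eventuallyBelow P h) →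
      P^[m] w ∈ frontier (eventuallyBelow P h) := by
    intro m w hw
    induction m with
    | zero => exact hw
    | succ m ih =>
      rw [Function.iterate_succ_apply']
      exact apply_mem_frontier_eventuallyBelow hc hstrict hh ih
  -- After `n` steps the two points are strictly ordered in every coordinate, so some basin point
  -- near `P^[n] v` lies above `P^[n] u`. This puts a frontier point into the open basin.
  have hlt := hstrong u v (lt_of_le_of_ne huv hne)
  have hu' := hiter n u hu
  have hv' := hiter n v hv
  rw [(isOpen_eventuallyBelow hc).frontier_eq] at hu' hv'
  have hopen : IsOpen (⋂ i, {w : ι → ℝ | P^[n] u i < w i}) :=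
    isOpen_iInter_of_finite fun i => isOpen_lt continuous_const (continuous_apply i)
  obtain ⟨a, ha, haA⟩ := mem_closure_iff.1 hv'.1 _ hopen (Set.mem_iInter.2 hlt)
  exact hu'.2 (mem_eventuallyBelow_of_le hmono (fun i => (Set.mem_iInter.1 ha i).le) haA)

end Basin

/-- If a strongly monotone map has a subsolution `l` above a point of the basin of the supersolution
`h` but not below `h`, then the basin has a fixed point in its boundary. -/
theorem exists_fixedPoint_mem_frontier [Fintype ι] {P : (ι → ℝ) → (ι → ℝ)} (hc : Continuous P)
    (hmono : Monotone P) (hstrict : ∀ u v, (∀ i, u i < v i) → ∀ i, P u i < P v i)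
    {n : ℕ} (hstrong : ∀ u v, u < v → ∀ i, P^[n] u i < P^[n] v i)
    {h l t : ι → ℝ} (hh : P h ≤ h) (hl : l ≤ P l) (ht : P t ≤ t) (hlt : l ≤ t)
    (hlA : l ∈ eventuallyBelow P h) (htA : t ∉ eventuallyBelow P h) :
    ∃ u ∈ frontier (eventuallyBelow P h), P u = u := by
  set A := eventuallyBelow P h with hA
  set M := frontier A with hM
  have huniq : ∀ u ∈ M, ∀ v ∈ M, u ≤ v → u = v := fun u hu v hv huv =>
    eq_of_le_of_mem_frontier_eventuallyBelow hc hmono hstrict hstrong hh hu hv huv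
  -- the monotone arc through `x` in the box, from the bottom corner to the top corner
  set c : (ι → ℝ) → ℝ → (ι → ℝ) := fun x s => ((x + fun _ => s) ⊔ l) ⊓ t with hcdef
  have hcc : Continuous fun p : (ι → ℝ) × ℝ => c p.1 p.2 := by
    have h1 : Continuous fun p : (ι → ℝ) × ℝ => (fun _ : ι => p.2) :=
      continuous_pi fun _ => continuous_snd
    refine continuous_pi fun i => ?_
    exact (((continuous_apply i).comp (continuous_fst.add h1)).sup continuous_const).inf
      continuous_const
  have hcmono : ∀ x, Monotone (c x) := fun x a b hab => by
    refine inf_le_inf_right _ (sup_le_sup_right (add_le_add_right (fun _ => hab) _) _)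
  have hcI : ∀ x s, c x s ∈ Set.Icc l t := fun x s => ⟨le_inf le_sup_right hlt, inf_le_right⟩
  have hc0 : ∀ x ∈ Set.Icc l t, c x 0 = x := fun x hx => by
    have : (x + fun _ => (0 : ℝ)) = x := by ext i; simp
    simp only [hcdef, this, sup_eq_left.2 hx.1, inf_eq_left.2 hx.2]
  obtain ⟨D, hD⟩ := exists_nat_forall_lt_add t l
  have hcD : ∀ x ∈ Set.Icc l t, c x D = t := fun x hx => by
    refine inf_eq_right.2 (le_trans (fun i => ?_) le_sup_left)
    have := hx.1 i
    simp only [Pi.add_apply]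
    linarith [hD i]
  have hcD' : ∀ x ∈ Set.Icc l t, c x (-D) = l := fun x hx => by
    have : (x + fun _ => (-D : ℝ)) ≤ l := fun i => by
      have := hx.2 i
      simp only [Pi.add_apply]
      linarith [hD i]
    simp only [hcdef, sup_eq_right.2 this, inf_eq_left.2 hlt]
  -- The arc runs from `l`, inside the basin, to `t`, outside it, and must cross the frontier.
  have hex : ∀ x ∈ Set.Icc l t, ∃ s ∈ Set.Icc (-D : ℝ) D, c x s ∈ M := by
    intro x hx
    have hpre : IsPreconnected (c x '' Set.Icc (-D : ℝ) D) :=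
      isPreconnected_Icc.image _ (hcc.comp (by fun_prop : Continuous fun s => (x, s))).continuousOn
    have hD0 : (-D : ℝ) ≤ D := by linarith [(Nat.cast_nonneg D : (0 : ℝ) ≤ D)]
    by_contra! hno
    have hopen := isOpen_eventuallyBelow (h := h) hc
    have hcover : c x '' Set.Icc (-D : ℝ) D ⊆ A ∪ (closure A)ᶜ := by
      rintro _ ⟨s, hs, rfl⟩
      have h1 := hno s hs
      rw [hM, hopen.frontier_eq] at h1
      by_cases h2 : c x s ∈ A
      · exact Or.inl h2
      · exact Or.inr fun h3 => h1 ⟨h3, h2⟩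
    have hlm : l ∈ c x '' Set.Icc (-D : ℝ) D := ⟨-D, ⟨le_rfl, hD0⟩, hcD' x hx⟩
    have htm : t ∈ c x '' Set.Icc (-D : ℝ) D := ⟨D, ⟨hD0, le_rfl⟩, hcD x hx⟩
    obtain ⟨y, -, hy1, hy2⟩ := hpre A (closure A)ᶜ hopen isClosed_closure.isOpen_compl hcover
      ⟨l, hlm, hlA⟩ ⟨t, htm, (hcover htm).resolve_left htA⟩
    exact hy2 (subset_closure hy1)
  choose! s hs hsM using hex
  -- The arc is totally ordered and the frontier has no two comparable points, so the crossing point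
  -- is unique, even though its parameter need not be.
  have hsuniq : ∀ x ∈ Set.Icc l t, ∀ s', c x s' ∈ M → c x s' = c x (s x) := by
    intro x hx s' hs'
    rcases le_total s' (s x) with h1 | h1
    · exact huniq _ hs' _ (hsM x hx) (hcmono x h1)
    · exact (huniq _ (hsM x hx) _ hs' (hcmono x h1)).symm
  -- the retraction of the box onto the boundary of the basin
  set r : (ι → ℝ) → (ι → ℝ) := fun x => c x (s x) with hr
  -- Parameters range in a compact interval, and every limit of crossing points is a crossing point
  -- of the limiting arc; uniqueness gives continuity.
  have hrcont : ContinuousOn r (Set.Icc l t) := by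
    intro x hx
    refine tendsto_of_subseq_tendsto fun y hy => ?_
    obtain ⟨hy1, hy2⟩ := tendsto_nhdsWithin_iff.1 hy
    obtain ⟨k, hk⟩ := eventually_atTop.1 hy2
    obtain ⟨a, -, m, hm, ha⟩ := (isCompact_Icc (a := (-D : ℝ)) (b := D)).tendsto_subseq
      (x := fun n => s (y (n + k))) fun n => hs _ (hk _ (Nat.le_add_left k n))
    have hidx : Tendsto (fun n => m n + k) atTop atTop :=
      tendsto_atTop_mono (fun n => Nat.le_add_right _ _) hm.tendsto_atTop
    have hlim : Tendsto (fun n => r (y (m n + k))) atTop (𝓝 (c x a)) :=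
      (hcc.tendsto (x, a)).comp ((hy1.comp hidx).prodMk_nhds ha)
    have hmem : c x a ∈ M := isClosed_frontier.mem_of_tendsto hlim
      (Eventually.of_forall fun n => hsM _ (hk _ (Nat.le_add_left k _)))
    refine ⟨fun n => m n + k, ?_⟩
    rw [hr]
    simp only
    rw [← hsuniq x hx a hmem]
    exact hlim
  have hPI : Set.MapsTo P (Set.Icc l t) (Set.Icc l t) := fun x hx =>
    ⟨hl.trans (hmono hx.1), (hmono hx.2).trans ht⟩
  -- A fixed point of `P ∘ r` lies on the frontier because `P` preserves it; there `r` is the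
  -- identity, so it is fixed by `P`.
  obtain ⟨x, hx, hfix⟩ := exists_fixedPoint_of_mapsTo_Icc hlt (f := fun x => P (r x))
    (hc.comp_continuousOn hrcont) (fun x hx => hPI (hcI x (s x)))
  have hxM : x ∈ M := by
    rw [← hfix]
    exact apply_mem_frontier_eventuallyBelow hc hstrict hh (hsM x hx)
  have hrx : r x = x := by
    have h1 := hsuniq x hx 0 (by rw [hc0 x hx]; exact hxM)
    rw [hc0 x hx] at h1
    exact h1.symm
  refine ⟨x, hxM, ?_⟩
  simp only [hrx] at hfix
  exact hfix

/-- A strongly monotone map commuting with integer translations that has a strict subsolution and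
a strict supersolution has two fixed points that are not integer translates of each other. -/
theorem exists_two_fixedPoints [Fintype ι] {P : (ι → ℝ) → (ι → ℝ)} (hc : Continuous P)
    (hmono : Monotone P) (hstrict : ∀ u v, (∀ i, u i < v i) → ∀ i, P u i < P v i)
    {n : ℕ} (hstrong : ∀ u v, u < v → ∀ i, P^[n] u i < P^[n] v i)
    (htrans : ∀ (u : ι → ℝ) (j : ℤ), P (fun i => u i + j) = fun i => P u i + j)
    {l h : ι → ℝ} (hl : l < P l) (hh : P h < h) :
    ∃ u v, P u = u ∧ P v = v ∧ ∀ j : ℤ, v ≠ fun i => u i + j := by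
  obtain ⟨i₀⟩ : Nonempty ι := by
    obtain ⟨i, -⟩ := (Pi.lt_def.1 hl).2
    exact ⟨i⟩
  have hsub : ∀ (w : ι → ℝ) (j : ℤ), w ≤ P w → (fun i => w i + j) ≤ P (fun i => w i + j) := by
    intro w j hw
    rw [htrans]
    exact fun i => add_le_add_left (hw i) _
  have hsup : ∀ (w : ι → ℝ) (j : ℤ), P w ≤ w → P (fun i => w i + j) ≤ (fun i => w i + j) := by
    intro w j hw
    rw [htrans]
    exact fun i => add_le_add_left (hw i) _
  obtain ⟨a, ha⟩ := exists_nat_forall_lt_add l h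
  obtain ⟨u₀, hu₀, -, hu₀h⟩ := exists_fixedPoint_of_sub_super hc hmono
    (l := fun i => l i + ((-a : ℤ) : ℝ)) (h := h)
    (fun i => by push_cast; linarith [ha i]) (hsub l _ hl.le) hh.le
  by_contra! hno
  -- every fixed point is an integer translate of `u₀`
  have hU : ∀ v, P v = v → ∃ j : ℤ, v = fun i => u₀ i + j := fun v hv => hno u₀ v hu₀ hv
  obtain ⟨p, hp, hpmax⟩ := Int.exists_greatest_of_bdd (P := fun j : ℤ => (fun i => u₀ i + j) ≤ h)
    ⟨⌈h i₀ - u₀ i₀⌉, fun z hz => by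
      have h1 := hz i₀
      have h2 := Int.le_ceil (h i₀ - u₀ i₀)
      simp only at h1
      exact_mod_cast (by linarith : (z : ℝ) ≤ ⌈h i₀ - u₀ i₀⌉)⟩
    ⟨0, by simpa using hu₀h⟩
  obtain ⟨q, hq, hqmin⟩ := Int.exists_least_of_bdd (P := fun j : ℤ => l ≤ fun i => u₀ i + j)
    ⟨⌊l i₀ - u₀ i₀⌋, fun z hz => by
      have h1 := hz i₀
      have h2 := Int.floor_le (l i₀ - u₀ i₀)
      simp only at h1
      exact_mod_cast (by linarith : (⌊l i₀ - u₀ i₀⌋ : ℝ) ≤ z)⟩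
    (by
      obtain ⟨m, hm⟩ := exists_nat_forall_lt_add l u₀
      exact ⟨m, fun i => by simpa using (hm i).le⟩)
  -- a translate of the subsolution lying below `u₀ + (p + 1)` but not below `u₀ + p`
  set l' : ι → ℝ := fun i => l i + ((p + 1 - q : ℤ) : ℝ) with hl'
  have hl'sub : l' < P l' := by
    rw [hl', htrans]
    obtain ⟨h1, i, h2⟩ := Pi.lt_def.1 hl
    exact Pi.lt_def.2 ⟨fun i => add_le_add_left (h1 i) _, i, by simpa using h2⟩
  have hl'u : l' ≤ fun i => u₀ i + ((p + 1 : ℤ) : ℝ) := fun i => by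
    have := hq i
    simp only [hl'] at this ⊢
    push_cast at this ⊢
    linarith
  have hl'p : ¬ l' ≤ fun i => u₀ i + (p : ℝ) := fun hle => by
    have := hqmin (q - 1) fun i => by
      have := hle i
      simp only [hl'] at this ⊢
      push_cast at this ⊢
      linarith
    omega
  -- Otherwise a fixed point between `l'` and `h` would be `u₀ + j` with `j ≤ p`, contradicting the
  -- choice of `l'`.
  have hl'h : ¬ l' ≤ h := fun hle => by
    obtain ⟨v, hv, hlv, hvh⟩ := exists_fixedPoint_of_sub_super hc hmono hle hl'sub.le hh.le
    obtain ⟨j, rfl⟩ := hU v hv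
    have hj := hpmax j hvh
    refine hl'p (hlv.trans fun i => ?_)
    have : (j : ℝ) ≤ p := by exact_mod_cast hj
    simpa using this
  have hfix : ∀ j : ℤ, P (fun i => u₀ i + j) = fun i => u₀ i + j := fun j => by rw [htrans, hu₀]
  have hiterfix : ∀ (j : ℤ) (m : ℕ), P^[m] (fun i => u₀ i + j) = fun i => u₀ i + j :=
    fun j m => Function.iterate_fixed (hfix j) m
  -- Orbits starting above `l'` stay above it; dropping below `h` would give `l' ≤ h`.
  have hup : ∀ v, l' ≤ v → v ∉ eventuallyBelow P h := by
    rintro v hv ⟨m, hm⟩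
    refine hl'h (le_trans ?_ fun i => (hm i).le)
    exact (hmono.monotone_iterate_of_le_map hl'sub.le (Nat.zero_le m)).trans (hmono.iterate m hv)
  -- The translate `l' - b` lies strictly below `h`, hence in the basin; `h + b` lies above `l'`,
  -- hence outside it.
  obtain ⟨b, hb⟩ := exists_nat_forall_lt_add l' h
  obtain ⟨w, hwM, hw⟩ := exists_fixedPoint_mem_frontier hc hmono hstrict hstrong hh.le
    (l := fun i => l' i + ((-b : ℤ) : ℝ)) (t := fun i => h i + ((b : ℤ) : ℝ))
    (hsub l' _ hl'sub.le) (hsup h _ hh.le)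
    (fun i => by
      have := hb i
      push_cast
      linarith [(Nat.cast_nonneg b : (0 : ℝ) ≤ b)])
    ⟨0, fun i => by
      have := hb i
      simp only [Function.iterate_zero, id_eq]
      push_cast
      linarith⟩
    (hup _ fun i => by simpa using (hb i).le)
  obtain ⟨j, rfl⟩ := hU w hw
  rw [(isOpen_eventuallyBelow hc).frontier_eq] at hwM
  rcases le_or_gt j p with hj | hj
  · -- then the fixed point belongs to the basin
    have hle : (fun i => u₀ i + (j : ℝ)) ≤ h := by
      refine le_trans (fun i => ?_) hp
      have : (j : ℝ) ≤ p := by exact_mod_cast hj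
      simpa using this
    have hlt : (fun i => u₀ i + (j : ℝ)) < h := by
      refine lt_of_le_of_ne hle fun heq => ?_
      have h1 := hfix j
      rw [heq] at h1
      exact hh.ne h1
    have h2 := hstrong _ _ hlt
    refine hwM.2 ⟨n, fun i => (h2 i).trans_le ?_⟩
    exact hmono.antitone_iterate_of_map_le hh.le (Nat.zero_le n) i
  · -- then the fixed point is interior to the complement of the basin
    have hle : l' ≤ fun i => u₀ i + (j : ℝ) := by
      refine hl'u.trans fun i => ?_
      have : ((p + 1 : ℤ) : ℝ) ≤ j := by exact_mod_cast hj
      simpa using this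
    have hlt : l' < fun i => u₀ i + (j : ℝ) := by
      refine lt_of_le_of_ne hle fun heq => ?_
      have h1 := hfix j
      rw [← heq] at h1
      exact hl'sub.ne h1.symm
    have h2 := hstrong _ _ hlt
    rw [hiterfix] at h2
    have hopen : IsOpen (⋂ i, {v : ι → ℝ | l' i < v i}) :=
      isOpen_iInter_of_finite fun i => isOpen_lt continuous_const (continuous_apply i)
    obtain ⟨v, hv, hvA⟩ := mem_closure_iff.1 hwM.1 _ hopen (Set.mem_iInter.2 fun i =>
      (hmono.monotone_iterate_of_le_map hl'sub.le (Nat.zero_le n) i).trans_lt (h2 i))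
    exact hup v (fun i => (Set.mem_iInter.1 hv i).le) hvA

end MonotoneMaps

/-! ### The recurrence generated by a twist map. -/

namespace TwistMap

/-- `I = g a b` and `J = h a b` are the equations of the graph of `T`, where `T (a, I) = (b, J)`. -/
structure IsGeneratingPair (T : Plane → Plane) (g h : ℝ → ℝ → ℝ) : Prop where
  apply_fst : ∀ a I, g a (T (a, I)).1 = I
  map_eq : ∀ a b, T (a, g a b) = (b, h a b)
  strictMono : ∀ a, StrictMono (g a)
  strictAnti : ∀ b, StrictAnti fun a => h a b
  left_add_int : ∀ (a b : ℝ) (m n : ℤ), g (a + m) (b + n) = g a b + n - m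
  right_add_int : ∀ (a b : ℝ) (m n : ℤ), h (a + m) (b + n) = h a b + n - m
  lipschitz : ∃ L : ℝ, 0 ≤ L ∧ (∀ a b a' b', |g a b - g a' b'| ≤ L * (|a - a'| + |b - b'|)) ∧
    ∀ a b a' b', |h a b - h a' b'| ≤ L * (|a - a'| + |b - b'|)

variable {T : Plane → Plane}

/-- A continuous function on the plane that is invariant under integer translations attains its
minimum. -/
theorem exists_forall_ge_of_periodic {f : Plane → ℝ} (hf : Continuous f)
    (hper : ∀ (z : Plane) (m n : ℤ), f (z + ((m : ℝ), (n : ℝ))) = f z) : ∃ z₀, ∀ z, f z₀ ≤ f z := by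
  obtain ⟨z₀, -, hz₀⟩ := (isCompact_Icc (a := (0 : ℝ)) (b := 1)).prod
    (isCompact_Icc (a := (0 : ℝ)) (b := 1)) |>.exists_isMinOn ⟨(0, 0), by simp⟩ hf.continuousOn
  refine ⟨z₀, fun z => ?_⟩
  rw [← hper z (-⌊z.1⌋) (-⌊z.2⌋)]
  refine hz₀ ⟨⟨?_, ?_⟩, ?_, ?_⟩ <;> simp only [Prod.fst_add, Prod.snd_add, Int.cast_neg]
  · linarith [Int.floor_le z.1]
  · linarith [Int.lt_floor_add_one z.1]
  · linarith [Int.floor_le z.2]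
  · linarith [Int.lt_floor_add_one z.2]

theorem IsTQ.apply_add (hT : IsTQ T) (z : Plane) (m n : ℤ) :
    T (z + ((m : ℝ), (n : ℝ))) = T z + ((m : ℝ) + n, (n : ℝ)) := by
  have h : T (z + ((m : ℝ), (n : ℝ))) = _ := hT.apply_add_int z.1 z.2 m n
  rw [h]
  ext
  · simp [add_assoc]
  · simp

theorem IsTQ.contDiff (hT : IsTQ T) : ContDiff ℝ 1 T := hT.diffeo.1

theorem IsTQ.bijective (hT : IsTQ T) : Function.Bijective T := by
  obtain ⟨-, g, -, hl, hr⟩ := hT.diffeo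
  exact ⟨hl.injective, hr.surjective⟩

theorem IsTQ.fderiv_add (hT : IsTQ T) (z : Plane) (m n : ℤ) :
    fderiv ℝ T (z + ((m : ℝ), (n : ℝ))) = fderiv ℝ T z := by
  rw [← fderiv_comp_add_right]
  have : (fun x : Plane => T (x + ((m : ℝ), (n : ℝ)))) =
      fun x => T x + ((m : ℝ) + n, (n : ℝ)) := funext fun x => hT.apply_add x m n
  rw [this, fderiv_add_const]

/-- The derivative is continuous and invariant under integer translations, hence bounded. -/
theorem IsTQ.exists_lipschitzWith (hT : IsTQ T) : ∃ K, LipschitzWith K T := by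
  have hc : Continuous (fderiv ℝ T) := hT.contDiff.continuous_fderiv one_ne_zero
  obtain ⟨z₀, hz₀⟩ := exists_forall_ge_of_periodic (f := fun z => -‖fderiv ℝ T z‖)
    (by fun_prop) (fun z m n => by rw [hT.fderiv_add])
  refine ⟨‖fderiv ℝ T z₀‖₊, lipschitzWith_of_nnnorm_fderiv_le
    (hT.contDiff.differentiable one_ne_zero) fun z => ?_⟩
  have := hz₀ z
  simp only [neg_le_neg_iff] at this
  exact this

theorem IsTQ.deriv_fst (hT : IsTQ T) (z : Plane) :
    HasDerivAt (fun t : ℝ => (T (z.1, t)).1) (fderiv ℝ T z (0, 1)).1 z.2 := by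
  have h1 : HasFDerivAt T (fderiv ℝ T z) (z.1, z.2) :=
    (hT.contDiff.differentiable one_ne_zero z).hasFDerivAt
  have h2 : HasDerivAt (fun t : ℝ => ((z.1, t) : Plane)) (0, 1) z.2 :=
    (hasDerivAt_const z.2 z.1).prodMk (hasDerivAt_id z.2)
  have h3 := h1.comp_hasDerivAt z.2 h2
  exact (hasFDerivAt_fst (p := T (z.1, z.2))).comp_hasDerivAt z.2 h3

/-- The twist is uniform. -/
theorem IsTQ.exists_twist_bound (hT : IsTQ T) :
    ∃ c > 0, ∀ a I J : ℝ, c * |I - J| ≤ |(T (a, I)).1 - (T (a, J)).1| := by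
  have hc : Continuous (fderiv ℝ T) := hT.contDiff.continuous_fderiv one_ne_zero
  obtain ⟨z₀, hz₀⟩ := exists_forall_ge_of_periodic (f := fun z => (fderiv ℝ T z (0, 1)).1)
    (by fun_prop) (fun z m n => by rw [hT.fderiv_add])
  have hpos : 0 < (fderiv ℝ T z₀ (0, 1)).1 := by
    rw [← (hT.deriv_fst z₀).deriv]
    exact hT.twist z₀.1 z₀.2
  refine ⟨_, hpos, fun a => ?_⟩
  have key : ∀ I J : ℝ, J ≤ I →
      (fderiv ℝ T z₀ (0, 1)).1 * (I - J) ≤ (T (a, I)).1 - (T (a, J)).1 := fun I J hJI =>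
    mul_sub_le_image_sub_of_le_deriv (f := fun t : ℝ => (T (a, t)).1)
      (fun t => (hT.deriv_fst (a, t)).differentiableAt)
      (fun t => by rw [(hT.deriv_fst (a, t)).deriv]; exact hz₀ (a, t)) hJI
  intro I J
  rcases le_total J I with h | h
  · rw [abs_of_nonneg (sub_nonneg.2 h)]
    exact (key I J h).trans (le_abs_self _)
  · rw [abs_sub_comm, abs_of_nonneg (sub_nonneg.2 h), abs_sub_comm]
    exact (key J I h).trans (le_abs_self _)

theorem IsTQ.strictMono_fst (hT : IsTQ T) (a : ℝ) : StrictMono fun I : ℝ => (T (a, I)).1 :=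
  strictMono_of_deriv_pos fun I => hT.twist a I

theorem IsTQ.exists_isGeneratingPair (hT : IsTQ T) : ∃ g h, IsGeneratingPair T g h := by
  have hTc : Continuous T := hT.contDiff.continuous
  have hsurj : ∀ a : ℝ, Function.Surjective fun I : ℝ => (T (a, I)).1 := fun a =>
    Continuous.surjective (by fun_prop) (hT.horiz_top a) (hT.horiz_bot a)
  choose g hg using hsurj
  have hg' : ∀ a b, (T (a, g a b)).1 = b := hg
  set h : ℝ → ℝ → ℝ := fun a b => (T (a, g a b)).2 with hh
  have happ : ∀ a I, g a (T (a, I)).1 = I := fun a I => (hT.strictMono_fst a).injective (hg' _ _)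
  have hmap : ∀ a b, T (a, g a b) = (b, h a b) := fun a b => Prod.ext (hg' a b) rfl
  have hint : ∀ (a b : ℝ) (m n : ℤ), g (a + m) (b + n) = g a b + n - m := by
    intro a b m n
    have h1 := hT.apply_add_int a (g a b) m (n - m)
    have h2 := happ (a + m) (g a b + ((n - m : ℤ) : ℝ))
    rw [h1, hg'] at h2
    push_cast at h2
    rw [show b + (m : ℝ) + (n - m) = b + n by ring] at h2
    rw [h2]
    ring
  have hint' : ∀ (a b : ℝ) (m n : ℤ), h (a + m) (b + n) = h a b + n - m := by
    intro a b m n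
    have h1 := hT.apply_add_int a (g a b) m (n - m)
    simp only [hh, hint]
    rw [show g a b + (n : ℝ) - m = g a b + ((n - m : ℤ) : ℝ) by push_cast; ring, h1]
    push_cast
    ring
  obtain ⟨K, hK⟩ := hT.exists_lipschitzWith
  obtain ⟨c, hc, htw⟩ := hT.exists_twist_bound
  have hK0 : (0 : ℝ) ≤ K := K.2
  have hKd : ∀ z w : Plane, dist (T z) (T w) ≤ K * (|z.1 - w.1| + |z.2 - w.2|) := fun z w => by
    refine (hK.dist_le_mul z w).trans (mul_le_mul_of_nonneg_left ?_ hK0)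
    rw [Prod.dist_eq, Real.dist_eq, Real.dist_eq]
    exact max_le (by linarith [abs_nonneg (z.2 - w.2)]) (by linarith [abs_nonneg (z.1 - w.1)])
  have hgl : ∀ a b a' b', |g a b - g a' b'| ≤ (K + 1) / c * (|a - a'| + |b - b'|) := by
    intro a b a' b'
    rw [div_mul_eq_mul_div, le_div_iff₀ hc, mul_comm]
    -- Both heights are compared on the single vertical line over `a'`, where the twist bound
    -- applies; moving from `a` to `a'` costs the Lipschitz constant of `T`.
    have h1 := htw a' (g a b) (g a' b')
    rw [hg'] at h1
    have h2 : |(T (a', g a b)).1 - b| ≤ K * |a' - a| := by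
      have h3 := hKd (a', g a b) (a, g a b)
      have h4 : dist (T (a', g a b)).1 (T (a, g a b)).1 ≤ _ := (le_max_left _ _).trans h3
      rw [hg', Real.dist_eq] at h4
      simpa using h4
    have h5 : |(T (a', g a b)).1 - b'| ≤ |(T (a', g a b)).1 - b| + |b - b'| := abs_sub_le _ _ _
    rw [abs_sub_comm a' a] at h2
    nlinarith [abs_nonneg (a - a'), abs_nonneg (b - b')]
  have hhl : ∀ a b a' b', |h a b - h a' b'| ≤
      K * ((K + 1) / c + 1) * (|a - a'| + |b - b'|) := by
    intro a b a' b'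
    have h1 := hKd (a, g a b) (a', g a' b')
    have h2 : dist (T (a, g a b)).2 (T (a', g a' b')).2 ≤ _ := (le_max_right _ _).trans h1
    rw [Real.dist_eq] at h2
    refine h2.trans ?_
    rw [mul_assoc]
    refine mul_le_mul_of_nonneg_left ?_ hK0
    simp only
    linarith [hgl a b a' b', abs_nonneg (b - b')]
  refine ⟨g, h, happ, hmap, ?_, ?_, hint, hint', ?_⟩
  · intro a b b' hbb
    by_contra hle
    have := (hT.strictMono_fst a).monotone (not_lt.1 hle)
    simp only [hg'] at this
    linarith
  · intro b
    have hcont : Continuous fun a => h a b := by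
      refine (LipschitzWith.of_dist_le_mul (K := Real.toNNReal (K * ((K + 1) / c + 1)))
        fun a a' => ?_).continuous
      have h1 := hhl a b a' b
      rw [sub_self, abs_zero, add_zero] at h1
      rw [Real.coe_toNNReal _ (by positivity)]
      exact h1
    -- Injectivity of `T` makes `h · b` strictly monotone, and `h (a + 1) b = h a b - 1` decides the
    -- direction.
    have hinj : Function.Injective fun a => h a b := by
      intro a a' haa
      have h1 : T (a, g a b) = T (a', g a' b) := by
        rw [hmap, hmap]
        exact Prod.ext rfl haa
      exact congrArg Prod.fst (hT.bijective.1 h1)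
    rcases hcont.strictMono_of_inj hinj with hm | hm
    · have h1 := hint' 0 b 1 0
      have h2 : h 0 b < h 1 b := hm zero_lt_one
      simp only [Int.cast_one, Int.cast_zero, zero_add, add_zero] at h1
      linarith
    · exact hm
  · refine ⟨max ((K + 1) / c) (K * ((K + 1) / c + 1)), by positivity, fun a b a' b' => ?_,
      fun a b a' b' => ?_⟩
    · exact (hgl a b a' b').trans (mul_le_mul_of_nonneg_right (le_max_left _ _) (by positivity))
    · exact (hhl a b a' b').trans (mul_le_mul_of_nonneg_right (le_max_right _ _) (by positivity))

end TwistMap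

/-! ### A fixed point from the vanishing of the flux. -/

namespace TwistMap

variable {T : Plane → Plane} {g h : ℝ → ℝ → ℝ}

theorem IsGeneratingPair.continuous_diag_left (hg : IsGeneratingPair T g h) :
    Continuous fun a => g a a := by
  obtain ⟨L, hL, hgl, -⟩ := hg.lipschitz
  refine (LipschitzWith.of_dist_le_mul (K := Real.toNNReal (L * 2)) fun a b => ?_).continuous
  rw [Real.coe_toNNReal _ (by positivity), Real.dist_eq, Real.dist_eq]
  refine (hgl a a b b).trans (le_of_eq (by ring))

theorem IsGeneratingPair.continuous_diag_right (hg : IsGeneratingPair T g h) :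
    Continuous fun a => h a a := by
  obtain ⟨L, hL, -, hhl⟩ := hg.lipschitz
  refine (LipschitzWith.of_dist_le_mul (K := Real.toNNReal (L * 2)) fun a b => ?_).continuous
  rw [Real.coe_toNNReal _ (by positivity), Real.dist_eq, Real.dist_eq]
  refine (hhl a a b b).trans (le_of_eq (by ring))

theorem coe_rep (x : UnitAddCircle) : ((rep x : ℝ) : UnitAddCircle) = x := AddCircle.coe_equivIco

/-- The open set below the graph of a function on the circle. -/
def below (γ : UnitAddCircle → ℝ) : Set Cylinder := {x | x.2 < γ x.1}

/-- The set below a continuous graph is homeomorphic to the cylinder. -/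
noncomputable def belowHomeomorph (γ : UnitAddCircle → ℝ) (hγ : Continuous γ) : below γ ≃ₜ Cylinder where
  toFun x := (x.1.1, Real.log (γ x.1.1 - x.1.2))
  invFun y := ⟨(y.1, γ y.1 - Real.exp y.2), by
    simp only [below, Set.mem_ofPred_eq]
    linarith [Real.exp_pos y.2]⟩
  left_inv x := by
    have hx : x.1.2 < γ x.1.1 := x.2
    apply Subtype.ext
    simp only [Real.exp_log (sub_pos.2 hx), sub_sub_cancel]
  right_inv y := by simp
  continuous_toFun := by
    have h1 : Continuous fun x : below γ => γ x.1.1 - x.1.2 := by fun_prop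
    have h2 : Continuous fun x : below γ => Real.log (γ x.1.1 - x.1.2) :=
      h1.log fun x => (sub_pos.2 (show x.1.2 < γ x.1.1 from x.2)).ne'
    fun_prop
  continuous_invFun := by fun_prop

/-- The circle function induced by a periodic function of the line. -/
theorem continuous_comp_rep {f : ℝ → ℝ} (hf : Continuous f)
    (hper : ∀ (a : ℝ) (n : ℤ), f (a + n) = f a) : Continuous fun x => f (rep x) := by
  have h1 : IsQuotientMap ((↑) : ℝ → UnitAddCircle) :=
    QuotientAddGroup.isQuotientMap_mk _
  rw [h1.continuous_iff]
  refine hf.congr fun a => ?_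
  obtain ⟨n, hn⟩ := rep_coe a
  simp only [Function.comp_apply, hn, hper]

/-- Both inequalities say that `T` decreases the first coordinate of `z`. -/
theorem IsGeneratingPair.snd_lt_iff (hg : IsGeneratingPair T g h) (z : Plane) :
    (T z).2 < h (T z).1 (T z).1 ↔ z.2 < g z.1 z.1 := by
  obtain ⟨a, I⟩ := z
  have h1 := hg.apply_fst a I
  set b := (T (a, I)).1 with hb
  have h2 : T (a, I) = (b, h a b) := by rw [← hg.map_eq a b, h1]
  rw [h2]
  simp only
  rw [(hg.strictAnti b).lt_iff_gt, ← h1, (hg.strictMono a).lt_iff_lt]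

/-- The induced map of the cylinder sends the set below the graph of `a ↦ g a a` onto the set below
the graph of `a ↦ h a a`. -/
theorem IsGeneratingPair.image_below (hT : IsTQ T) (hg : IsGeneratingPair T g h) :
    cylinderMap T '' below (fun x => g (rep x) (rep x)) = below fun x => h (rep x) (rep x) := by
  have hgm : ∀ z : Plane, toCylinder z ∈ below (fun x => g (rep x) (rep x)) ↔
      z.2 < g z.1 z.1 := by
    intro z
    obtain ⟨n, hn⟩ := rep_coe z.1
    have := hg.left_add_int z.1 z.1 n n
    simp only [below, toCylinder, Set.mem_ofPred_eq, hn, this, add_sub_cancel_right]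
  have hhm : ∀ z : Plane, toCylinder z ∈ below (fun x => h (rep x) (rep x)) ↔
      z.2 < h z.1 z.1 := by
    intro z
    obtain ⟨n, hn⟩ := rep_coe z.1
    have := hg.right_add_int z.1 z.1 n n
    simp only [below, toCylinder, Set.mem_ofPred_eq, hn, this, add_sub_cancel_right]
  have hlift : ∀ x : Cylinder, toCylinder (rep x.1, x.2) = x := fun x => by
    simp only [toCylinder, coe_rep]
  apply Set.Subset.antisymm
  · rintro _ ⟨x, hx, rfl⟩
    rw [← hlift x] at hx ⊢
    rw [hT.cylinderMap_toCylinder, hhm, hg.snd_lt_iff]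
    exact (hgm _).1 hx
  · intro y hy
    rw [← hlift y] at hy ⊢
    obtain ⟨z, hz⟩ := hT.bijective.2 (rep y.1, y.2)
    rw [← hz, hhm, hg.snd_lt_iff] at hy
    exact ⟨toCylinder z, (hgm z).2 hy, by rw [hT.cylinderMap_toCylinder, hz]⟩

theorem measure_below_sdiff_lt {μ : Measure Cylinder} (hpos : ∀ U : Set Cylinder, IsOpen U → U.Nonempty →
    0 < μ U) {γ₁ γ₂ : UnitAddCircle → ℝ} (h₁ : Continuous γ₁) (h₂ : Continuous γ₂)
    (hlt : ∀ x, γ₁ x < γ₂ x) : μ (below γ₁ \ below γ₂) < μ (below γ₂ \ below γ₁) := by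
  have hsub : below γ₁ ⊆ below γ₂ := fun x hx => lt_trans (show x.2 < γ₁ x.1 from hx) (hlt x.1)
  rw [Set.sdiff_eq_empty.2 hsub, measure_empty]
  set U : Set Cylinder := {x | γ₁ x.1 < x.2} ∩ {x | x.2 < γ₂ x.1} with hU
  have hUo : IsOpen U := (isOpen_lt (by fun_prop) (by fun_prop)).inter
    (isOpen_lt (by fun_prop) (by fun_prop))
  have hUn : U.Nonempty := by
    obtain ⟨y, hy1, hy2⟩ := exists_between (hlt 0)
    exact ⟨(0, y), hy1, hy2⟩
  refine (hpos U hUo hUn).trans_le (measure_mono fun x hx => ⟨hx.2, fun hlow => ?_⟩)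
  exact lt_asymm (show γ₁ x.1 < x.2 from hx.1) hlow

/-- A `μ`-exact map in `TQ` has a fixed point in the plane, at `(a, g a a)`. -/
theorem IsExact.exists_diag_eq (hT : IsTQ T) (hg : IsGeneratingPair T g h) {μ : Measure Cylinder}
    (hμ : IsExact μ (cylinderMap T)) : ∃ a, g a a = h a a := by
  -- If the diagonals of `g` and `h` never meet, one graph lies strictly above the other. The open
  -- strip between them has positive measure and is crossed in one direction only, against
  -- exactness.
  by_contra! hne
  have hγc : Continuous fun x : UnitAddCircle => g (rep x) (rep x) :=
    continuous_comp_rep hg.continuous_diag_left fun a n => by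
      rw [hg.left_add_int, add_sub_cancel_right]
  have hγc' : Continuous fun x : UnitAddCircle => h (rep x) (rep x) :=
    continuous_comp_rep hg.continuous_diag_right fun a n => by
      rw [hg.right_add_int, add_sub_cancel_right]
  obtain ⟨lo, hlo⟩ := (isCompact_range hγc).bddBelow
  obtain ⟨hi, hhi⟩ := (isCompact_range hγc).bddAbove
  have hflux := hμ.flux (below fun x => g (rep x) (rep x))
    (isOpen_lt continuous_snd (hγc.comp continuous_fst)) ⟨belowHomeomorph _ hγc⟩
    ⟨lo, hi, fun x hx => hx.trans_le (hlo ⟨x.1, rfl⟩),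
      fun x hx => lt_of_lt_of_le (show x.2 < g (rep x.1) (rep x.1) from hx) (hhi ⟨x.1, rfl⟩)⟩
  rw [hg.image_below hT] at hflux
  have hd : Continuous fun a => g a a - h a a :=
    hg.continuous_diag_left.sub hg.continuous_diag_right
  have hsign : (∀ a, g a a < h a a) ∨ ∀ a, h a a < g a a := by
    by_contra! hcon
    obtain ⟨⟨a, ha⟩, b, hb⟩ := hcon
    obtain ⟨c, hc⟩ := mem_range_of_exists_le_of_exists_ge hd (c := 0)
      ⟨b, by linarith⟩ ⟨a, by linarith⟩
    exact hne c (by simpa [sub_eq_zero] using hc)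
  rcases hsign with hs | hs
  · exact (measure_below_sdiff_lt hμ.pos hγc hγc' fun x => hs (rep x)).ne' hflux
  · exact (measure_below_sdiff_lt hμ.pos hγc' hγc fun x => hs (rep x)).ne hflux

end TwistMap

/-! ### Cyclic sub- and supersolutions and the relaxation map. -/

namespace TwistMap

/-- The defect of a cyclic configuration `u` from satisfying the recurrence with forcing `e`. -/
def defect {N : ℕ} (g h : ℝ → ℝ → ℝ) (e u : ZMod N → ℝ) (i : ZMod N) : ℝ :=
  g (u i) (u (i + 1)) - h (u (i - 1)) (u i) + e i

variable {T : Plane → Plane} {g h : ℝ → ℝ → ℝ} {N : ℕ}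

/-- The cyclic configuration of minima, over the residue classes modulo `N`, of a solution on `ℤ`
that goes to `+∞` at both ends is a strict supersolution. -/
theorem exists_strict_super [NeZero N] (hg : ∀ a, StrictMono (g a))
    (hh : ∀ b, StrictAnti fun a => h a b) (e : ZMod N → ℝ) {w : ℤ → ℝ}
    (hw : ∀ i : ℤ, g (w i) (w (i + 1)) - h (w (i - 1)) (w i) + e i = 0)
    (hlim : Tendsto w cofinite atTop) :
    ∃ v : ZMod N → ℝ, (∀ i, defect g h e v i ≤ 0) ∧ ∃ i, defect g h e v i < 0 := by
  have hmin : ∀ r : ZMod N, ∃ j : ℤ, (j : ZMod N) = r ∧ ∀ i : ℤ, (i : ZMod N) = r → w j ≤ w i := by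
    intro r
    obtain ⟨j₀, hj₀⟩ := ZMod.intCast_surjective r
    have : Nonempty {i : ℤ // (i : ZMod N) = r} := ⟨⟨j₀, hj₀⟩⟩
    obtain ⟨j, hj⟩ := (hlim.comp (Subtype.val_injective
      (p := fun i : ℤ => (i : ZMod N) = r)).tendsto_cofinite).exists_forall_le
    exact ⟨j.1, j.2, fun i hi => hj ⟨i, hi⟩⟩
  choose j hj hjmin using hmin
  set v : ZMod N → ℝ := fun r => w (j r) with hv
  have hle : ∀ i : ℤ, v i ≤ w i := fun i => hjmin i i rfl
  have hnext : ∀ r, v (r + 1) ≤ w (j r + 1) := fun r => by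
    have := hle (j r + 1)
    rwa [Int.cast_add, hj, Int.cast_one] at this
  have hprev : ∀ r, v (r - 1) ≤ w (j r - 1) := fun r => by
    have := hle (j r - 1)
    rwa [Int.cast_sub, hj, Int.cast_one] at this
  have hsol : ∀ (r : ZMod N) (i : ℤ), (i : ZMod N) = r →
      g (w i) (w (i + 1)) - h (w (i - 1)) (w i) + e r = 0 := fun r i hi => hi ▸ hw i
  -- At a minimiser the neighbours of `v` lie below those of `w`, and the defect is nondecreasing in
  -- both neighbours.
  have hsuper : ∀ r, defect g h e v r ≤ 0 := fun r => by
    have h1 := (hg (v r)).monotone (hnext r)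
    have h2 := (hh (v r)).antitone (hprev r)
    have h3 := hsol r (j r) (hj r)
    simp only [defect, hv] at h1 h2 h3 ⊢
    linarith
  refine ⟨v, hsuper, ?_⟩
  -- If the defect vanished identically, strictness of `g` would propagate `v = w` to the right from
  -- `j 0`, and `w` would take the value `v 0` infinitely often.
  by_contra! hge
  have hzero : ∀ r, defect g h e v r = 0 := fun r => le_antisymm (hsuper r) (hge r)
  have hstep : ∀ i : ℤ, v i = w i → v ((i + 1 : ℤ) : ZMod N) = w (i + 1) := by
    intro i hi
    refine le_antisymm (hle _) (not_lt.1 fun hlt => ?_)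
    have h1 := hg (v i) hlt
    have h2 := (hh (v i)).antitone (hle (i - 1))
    have h3 := hw i
    have h4 := hzero i
    simp only [defect] at h1 h2 h4
    push_cast at h1 h2
    rw [← hi] at h3
    linarith
  have hall : ∀ m : ℕ, v ((j 0 + m : ℤ) : ZMod N) = w (j 0 + m) := by
    intro m
    induction m with
    | zero => simp [hj, hv]
    | succ m ih =>
      have := hstep _ ih
      rw [add_assoc] at this
      exact_mod_cast this
  have hconst : ∀ m : ℕ, w (j 0 + (N * m : ℕ)) = v 0 := by
    intro m
    rw [← hall]
    congr 1
    push_cast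
    simp [hj]
  have hfin : {i : ℤ | w i ≤ v 0}.Finite := by
    have := hlim.eventually_gt_atTop (v 0)
    rw [eventually_cofinite] at this
    simpa using this
  refine hfin.not_infinite ?_
  refine (Set.infinite_range_of_injective (f := fun m : ℕ => j 0 + ((N * m : ℕ) : ℤ)) ?_).mono ?_
  · intro a b hab
    have : N * a = N * b := by exact_mod_cast add_left_cancel hab
    exact Nat.eq_of_mul_eq_mul_left (NeZero.pos N) this
  · rintro _ ⟨m, rfl⟩
    exact (hconst m).le

/-- The reflection `u ↦ -u` preserves the form of the recurrence and exchanges super- and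
subsolutions. -/
theorem exists_strict_sub [NeZero N] (hg : ∀ a, StrictMono (g a))
    (hh : ∀ b, StrictAnti fun a => h a b) (e : ZMod N → ℝ) {w : ℤ → ℝ}
    (hw : ∀ i : ℤ, g (w i) (w (i + 1)) - h (w (i - 1)) (w i) + e i = 0)
    (hlim : Tendsto w cofinite atBot) :
    ∃ v : ZMod N → ℝ, (∀ i, 0 ≤ defect g h e v i) ∧ ∃ i, 0 < defect g h e v i := by
  obtain ⟨v, hv1, i, hv2⟩ := exists_strict_super (N := N) (g := fun a b => -g (-a) (-b))
    (h := fun a b => -h (-a) (-b)) (fun a b b' hb => neg_lt_neg (hg _ (neg_lt_neg hb)))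
    (fun b a a' ha => neg_lt_neg (hh _ (neg_lt_neg ha))) (fun i => -e i) (w := fun i => -w i)
    (fun i => by simp only [neg_neg]; linarith [hw i]) (tendsto_neg_atBot_atTop.comp hlim)
  refine ⟨fun i => -v i, fun r => ?_, i, ?_⟩
  · have := hv1 r
    simp only [defect] at this ⊢
    linarith
  · simp only [defect] at hv2 ⊢
    linarith

/-- The relaxation step of size `ε`. -/
def relax (g h : ℝ → ℝ → ℝ) (e : ZMod N → ℝ) (ε : ℝ) (u : ZMod N → ℝ) : ZMod N → ℝ :=
  fun i => u i + ε * defect g h e u i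

section Relax

variable {e : ZMod N → ℝ} {L ε : ℝ}

/-- The defect increases with the neighbours and loses at most `2 * L` times the increase of `u i`,
which the identity term absorbs when `ε * (2 * L) < 1`. Strictness from the right neighbour is
enough for strong monotonicity. -/
theorem relax_le_and_lt (hg : IsGeneratingPair T g h)
    (hgl : ∀ a b a' b', |g a b - g a' b'| ≤ L * (|a - a'| + |b - b'|))
    (hhl : ∀ a b a' b', |h a b - h a' b'| ≤ L * (|a - a'| + |b - b'|))
    (hε : 0 < ε) (hεL : ε * (2 * L) < 1) {u v : ZMod N → ℝ} (huv : u ≤ v) (i : ZMod N) :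
    relax g h e ε u i ≤ relax g h e ε v i ∧
      ((u i < v i ∨ u (i + 1) < v (i + 1)) → relax g h e ε u i < relax g h e ε v i) := by
  have hi := huv i
  have h1 : -(L * (v i - u i)) ≤ g (v i) (u (i + 1)) - g (u i) (u (i + 1)) := by
    have := hgl (v i) (u (i + 1)) (u i) (u (i + 1))
    rw [sub_self, abs_zero, add_zero, abs_of_nonneg (sub_nonneg.2 hi)] at this
    exact (abs_le.1 this).1
  have h2 : h (u (i - 1)) (v i) - h (u (i - 1)) (u i) ≤ L * (v i - u i) := by
    have := hhl (u (i - 1)) (v i) (u (i - 1)) (u i)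
    rw [sub_self, abs_zero, zero_add, abs_of_nonneg (sub_nonneg.2 hi)] at this
    exact (abs_le.1 this).2
  have h3 : g (v i) (u (i + 1)) ≤ g (v i) (v (i + 1)) := (hg.strictMono _).monotone (huv _)
  have h4 : h (v (i - 1)) (v i) ≤ h (u (i - 1)) (v i) := (hg.strictAnti (v i)).antitone (huv _)
  have hkey : (1 - ε * (2 * L)) * (v i - u i) +
      ε * (g (v i) (v (i + 1)) - g (v i) (u (i + 1))) ≤
      relax g h e ε v i - relax g h e ε u i := by
    simp only [relax, defect]
    have h5 : 0 ≤ ε * ((g (v i) (u (i + 1)) - g (u i) (u (i + 1)) + L * (v i - u i)) +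
      (L * (v i - u i) - (h (u (i - 1)) (v i) - h (u (i - 1)) (u i))) +
      (h (u (i - 1)) (v i) - h (v (i - 1)) (v i))) := mul_nonneg hε.le (by linarith)
    linarith
  have h6 : 0 ≤ (1 - ε * (2 * L)) * (v i - u i) := mul_nonneg (by linarith) (by linarith)
  have h7 : 0 ≤ ε * (g (v i) (v (i + 1)) - g (v i) (u (i + 1))) :=
    mul_nonneg hε.le (by linarith)
  refine ⟨by linarith, fun hor => ?_⟩
  rcases hor with hlt | hlt
  · have : 0 < (1 - ε * (2 * L)) * (v i - u i) := mul_pos (by linarith) (by linarith)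
    linarith
  · have : 0 < ε * (g (v i) (v (i + 1)) - g (v i) (u (i + 1))) :=
      mul_pos hε (sub_pos.2 (hg.strictMono _ hlt))
    linarith

end Relax

theorem continuous_uncurry_of_lipschitz {f : ℝ → ℝ → ℝ} {L : ℝ} (hL : 0 ≤ L)
    (hf : ∀ a b a' b', |f a b - f a' b'| ≤ L * (|a - a'| + |b - b'|)) :
    Continuous fun p : ℝ × ℝ => f p.1 p.2 := by
  refine (LipschitzWith.of_dist_le_mul (K := Real.toNNReal (L * 2)) fun p q => ?_).continuous
  rw [Real.coe_toNNReal _ (by positivity), Real.dist_eq, mul_assoc]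
  refine (hf _ _ _ _).trans (mul_le_mul_of_nonneg_left ?_ hL)
  have h1 : |p.1 - q.1| ≤ dist p q := le_max_left _ _
  have h2 : |p.2 - q.2| ≤ dist p q := le_max_right _ _
  linarith

/-- If the forced recurrence has solutions on `ℤ` that go to `+∞`, respectively `-∞`, at both ends,
then it has two `N`-periodic solutions that are not integer translates of each other. -/
theorem IsGeneratingPair.exists_two_cyclic_solutions [NeZero N] (hg : IsGeneratingPair T g h)
    (e : ZMod N → ℝ) {w w' : ℤ → ℝ}
    (hw : ∀ i : ℤ, g (w i) (w (i + 1)) - h (w (i - 1)) (w i) + e i = 0)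
    (hlim : Tendsto w cofinite atTop)
    (hw' : ∀ i : ℤ, g (w' i) (w' (i + 1)) - h (w' (i - 1)) (w' i) + e i = 0)
    (hlim' : Tendsto w' cofinite atBot) :
    ∃ u v : ZMod N → ℝ, (∀ i, defect g h e u i = 0) ∧ (∀ i, defect g h e v i = 0) ∧
      ∀ j : ℤ, v ≠ fun i => u i + j := by
  obtain ⟨L, hL, hgl, hhl⟩ := hg.lipschitz
  set ε : ℝ := 1 / (2 * L + 1) with hεdef
  have hε : 0 < ε := by positivity
  have hεL : ε * (2 * L) < 1 := by
    rw [hεdef, div_mul_eq_mul_div, one_mul, div_lt_one (by positivity)]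
    linarith
  set P := relax g h e ε with hP
  have key : ∀ {u v : ZMod N → ℝ}, u ≤ v → ∀ i, P u i ≤ P v i ∧
      ((u i < v i ∨ u (i + 1) < v (i + 1)) → P u i < P v i) := fun huv i =>
    relax_le_and_lt hg hgl hhl hε hεL huv i
  have hgc := continuous_uncurry_of_lipschitz hL hgl
  have hhc := continuous_uncurry_of_lipschitz hL hhl
  have hc : Continuous P := by
    refine continuous_pi fun i => ?_
    have h1 : Continuous fun u : ZMod N → ℝ => g (u i) (u (i + 1)) :=
      hgc.comp (by fun_prop : Continuous fun u : ZMod N → ℝ => (u i, u (i + 1)))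
    have h2 : Continuous fun u : ZMod N → ℝ => h (u (i - 1)) (u i) :=
      hhc.comp (by fun_prop : Continuous fun u : ZMod N → ℝ => (u (i - 1), u i))
    simp only [hP, relax, defect]
    fun_prop
  have hmono : Monotone P := fun u v huv i => (key huv i).1
  have hstrict : ∀ u v : ZMod N → ℝ, (∀ i, u i < v i) → ∀ i, P u i < P v i := fun u v huv i =>
    (key (fun i => (huv i).le) i).2 (Or.inl (huv i))
  have hstrong : ∀ u v : ZMod N → ℝ, u < v → ∀ i, P^[N] u i < P^[N] v i := by
    intro u v huv
    obtain ⟨hle, i₀, hi₀⟩ := Pi.lt_def.1 huv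
    -- A strict inequality persists and spreads one site to the left per step, so `N` steps cover
    -- the cycle.
    have hspread : ∀ m t : ℕ, t ≤ m → P^[m] u (i₀ - t) < P^[m] v (i₀ - t) := by
      intro m
      induction m with
      | zero => intro t ht; simpa [Nat.le_zero.1 ht] using hi₀
      | succ m ih =>
        intro t ht
        rw [Function.iterate_succ_apply', Function.iterate_succ_apply']
        refine (key (hmono.iterate m hle) _).2 ?_
        rcases Nat.lt_or_ge t (m + 1) with h1 | h1
        · exact Or.inl (ih t (by omega))
        · right
          have h2 : t = m + 1 := by omega
          subst h2
          have h3 : i₀ - ((m + 1 : ℕ) : ZMod N) + 1 = i₀ - (m : ZMod N) := by push_cast; ring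
          rw [h3]
          exact ih m le_rfl
    intro i
    have h1 := hspread N (i₀ - i).val (ZMod.val_lt _).le
    rw [ZMod.natCast_val, ZMod.cast_id', id_eq, sub_sub_cancel] at h1
    exact h1
  have htrans : ∀ (u : ZMod N → ℝ) (j : ℤ), P (fun i => u i + j) = fun i => P u i + j := by
    intro u j
    ext i
    simp only [hP, relax, defect, hg.left_add_int, hg.right_add_int]
    ring
  have hfix : ∀ u, P u = u → ∀ i, defect g h e u i = 0 := by
    intro u hu i
    have h1 : u i + ε * defect g h e u i = u i := congrFun hu i
    have h2 : ε * defect g h e u i = 0 := by linarith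
    exact (mul_eq_zero.1 h2).resolve_left hε.ne'
  obtain ⟨θ, hθ, i, hi⟩ := exists_strict_super hg.strictMono hg.strictAnti e hw hlim
  obtain ⟨σ, hσ, j, hj⟩ := exists_strict_sub hg.strictMono hg.strictAnti e hw' hlim'
  have hθP : P θ < θ := Pi.lt_def.2 ⟨fun r => by
      have := mul_nonpos_of_nonneg_of_nonpos hε.le (hθ r)
      simp only [hP, relax]
      linarith, i, by
      have := mul_neg_of_pos_of_neg hε hi
      simp only [hP, relax]
      linarith⟩
  have hσP : σ < P σ := Pi.lt_def.2 ⟨fun r => by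
      have := mul_nonneg hε.le (hσ r)
      simp only [hP, relax]
      linarith, j, by
      have := mul_pos hε hj
      simp only [hP, relax]
      linarith⟩
  obtain ⟨u, v, hu, hv, huv⟩ := exists_two_fixedPoints hc hmono hstrict hstrong htrans hσP hθP
  exact ⟨u, v, hfix u hu, hfix v hv, huv⟩

end TwistMap

/-! ### Quadratic growth and orbit sequences. -/

namespace TwistMap

variable {T : Plane → Plane} {g h : ℝ → ℝ → ℝ}

/-- Every integer sequence on `ℤ` is a difference sequence. -/
theorem exists_forall_succ_eq_add (d : ℤ → ℤ) : ∃ c : ℤ → ℤ, ∀ i, c (i + 1) = c i + d i := by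
  refine ⟨fun i => ∑ j ∈ Finset.range i.toNat, d j -
    ∑ j ∈ Finset.range (-i).toNat, d (-(j : ℤ) - 1), fun i => ?_⟩
  rcases le_or_gt 0 i with hi | hi
  · obtain ⟨n, rfl⟩ := Int.eq_ofNat_of_zero_le hi
    have h1 : ((n : ℤ) + 1).toNat = n + 1 := by omega
    have h2 : (-((n : ℤ) + 1)).toNat = 0 := by omega
    have h3 : (-(n : ℤ)).toNat = 0 := by omega
    simp only [h1, h2, h3, Int.toNat_natCast, Finset.sum_range_succ, Finset.range_zero,
      Finset.sum_empty, sub_zero]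
  · obtain ⟨n, hn⟩ := Int.eq_ofNat_of_zero_le (show 0 ≤ -i - 1 by omega)
    obtain rfl : i = -(n : ℤ) - 1 := by omega
    have h1 : (-(n : ℤ) - 1 + 1).toNat = 0 := by omega
    have h2 : (-(n : ℤ) - 1).toNat = 0 := by omega
    have h3 : (-(-(n : ℤ) - 1)).toNat = n + 1 := by omega
    have h4 : (-(-(n : ℤ) - 1 + 1)).toNat = n := by omega
    simp only [h1, h2, h3, h4, Finset.sum_range_succ, Finset.range_zero, Finset.sum_empty]
    ring

/-- A periodic real sequence on `ℤ` is bounded. -/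
theorem exists_abs_le_of_periodic {p : ℤ → ℝ} {L : ℕ} (hL : 0 < L)
    (hp : ∀ i, p (i + L) = p i) : ∃ M, ∀ i, |p i| ≤ M := by
  have hper : Function.Periodic p (L : ℤ) := hp
  obtain ⟨M, hM⟩ := ((Set.finite_Ico (0 : ℤ) L).image fun i => |p i|).bddAbove
  refine ⟨M, fun i => ?_⟩
  have hL' : (0 : ℤ) < L := by exact_mod_cast hL
  have h1 : p (i % L) = p i := by
    have := hper.sub_zsmul_eq (x := i) (i / L)
    rw [← this, smul_eq_mul]
    congr 1
    rw [Int.emod_def, mul_comm]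
  rw [← h1]
  exact hM ⟨i % L, ⟨Int.emod_nonneg _ hL'.ne', Int.emod_lt_of_pos _ hL'⟩, rfl⟩

/-- With `α` and `γ` chosen to match the increments, `w i - α * i ^ 2 - γ * i` is `L`-periodic,
hence bounded, and `α > 0`. -/
theorem tendsto_atTop_of_quadratic_growth {w : ℤ → ℝ} {L : ℕ} (hL : 0 < L) {A β : ℝ} (hβ : 0 < β)
    (hw : ∀ i : ℤ, w (i + L) = w i + A + β * i) : Tendsto w cofinite atTop := by
  have hL' : (0 : ℝ) < L := by exact_mod_cast hL
  set α := β / (2 * L) with hα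
  set γ := (A - α * L ^ 2) / L with hγ
  have hαpos : 0 < α := by positivity
  have hαL : α * (2 * L) = β := by rw [hα]; field_simp
  have hγL : γ * L = A - α * L ^ 2 := by rw [hγ]; field_simp
  obtain ⟨M, hM⟩ := exists_abs_le_of_periodic (p := fun i => w i - α * i ^ 2 - γ * i) hL
    fun i => by
      simp only [hw]
      push_cast
      linear_combination -(i : ℝ) * hαL - hγL
  have habs : Tendsto (fun i : ℤ => |(i : ℝ)|) cofinite atTop :=
    (tendsto_norm_cocompact_atTop (E := ℝ)).comp Int.tendsto_coe_cofinite
  refine tendsto_atTop_mono (fun i => ?_)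
    (tendsto_atTop_add_const_right _ (-M - (|γ| + 1) ^ 2 / (4 * α)) habs)
  have h1 := (abs_le.1 (hM i)).1
  have h2 : -(|γ| * |(i : ℝ)|) ≤ γ * i := by
    rw [← abs_mul]
    exact neg_abs_le _
  have h3 : 0 ≤ α * |(i : ℝ)| ^ 2 - (|γ| + 1) * |(i : ℝ)| + (|γ| + 1) ^ 2 / (4 * α) := by
    have : α * |(i : ℝ)| ^ 2 - (|γ| + 1) * |(i : ℝ)| + (|γ| + 1) ^ 2 / (4 * α) =
        (2 * α * |(i : ℝ)| - (|γ| + 1)) ^ 2 / (4 * α) := by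
      field_simp
      ring
    rw [this]
    positivity
  rw [sq_abs] at h3
  linarith

theorem tendsto_atBot_of_quadratic_growth {w : ℤ → ℝ} {L : ℕ} (hL : 0 < L) {A β : ℝ} (hβ : β < 0)
    (hw : ∀ i : ℤ, w (i + L) = w i + A + β * i) : Tendsto w cofinite atBot := by
  have := tendsto_atTop_of_quadratic_growth (w := fun i => -w i) hL (A := -A) (neg_pos.2 hβ)
    fun i => by rw [hw]; ring
  exact tendsto_neg_atTop_iff.1 this

theorem exists_add_mul_eq {x : ℤ → ℝ} {n : ℕ} {A B : ℝ}
    (hx : ∀ i : ℤ, x (i + n) = x i + A + B * i) (m : ℕ) :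
    ∃ A' : ℝ, ∀ i : ℤ, x (i + (m * n : ℕ)) = x i + A' + m * B * i := by
  induction m with
  | zero => exact ⟨0, fun i => by simp⟩
  | succ m ih =>
    obtain ⟨A', h'⟩ := ih
    refine ⟨A' + A + B * (m * n : ℕ), fun i => ?_⟩
    have h1 : i + (((m + 1) * n : ℕ) : ℤ) = (i + (m * n : ℕ)) + n := by push_cast; ring
    rw [h1, hx, h']
    push_cast
    ring

/-- An integer sequence whose second difference is `k` at the multiples of `N` and zero elsewhere. -/
theorem exists_second_difference (N : ℕ) [NeZero N] (k : ℤ) :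
    ∃ c : ℤ → ℤ, (∀ i : ℤ, c (i + 1) - 2 * c i + c (i - 1) = if (i : ZMod N) = 0 then k else 0) ∧
      ∃ C : ℤ, ∀ i, c (i + N) = c i + C + k * i := by
  have hN : (0 : ℤ) < N := by exact_mod_cast NeZero.pos N
  -- The integer quotient `i / N` jumps by one exactly at the multiples of `N`.
  obtain ⟨c, hc⟩ := exists_forall_succ_eq_add fun i => k * (i / N)
  refine ⟨c, fun i => ?_, c N - c 0, fun i => ?_⟩
  · have h1 := hc i
    have h2 := hc (i - 1)
    rw [sub_add_cancel] at h2
    have h3 : c (i + 1) - 2 * c i + c (i - 1) = k * (i / N - (i - 1) / N) := by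
      rw [mul_sub]
      linarith
    rw [h3]
    split_ifs with hd <;> rw [ZMod.intCast_zmod_eq_zero_iff_dvd] at hd
    · obtain ⟨q, rfl⟩ := hd
      have h4 : (N : ℤ) * q / N = q := Int.mul_ediv_cancel_left _ hN.ne'
      have h5 : ((N : ℤ) * q - 1) / N = q - 1 := by
        rw [Int.ediv_eq_iff_of_pos hN]
        constructor <;> nlinarith
      rw [h4, h5]
      ring
    · have h4 : (i - 1) / N = i / N := by
        rw [Int.ediv_eq_iff_of_pos hN]
        have h5 := Int.emod_add_mul_ediv i N
        have h6 := Int.emod_lt_of_pos i hN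
        have h7 : 0 < i % N := lt_of_le_of_ne (Int.emod_nonneg _ hN.ne')
          fun h0 => hd (Int.dvd_of_emod_eq_zero h0.symm)
        constructor <;> nlinarith
      rw [h4, sub_self, mul_zero]
  · have hstep : ∀ j : ℤ, c (j + 1 + N) - c (j + 1) - k * (j + 1) = c (j + N) - c j - k * j := by
      intro j
      have h1 := hc (j + N)
      have h2 := hc j
      rw [Int.add_ediv_of_dvd_right (dvd_refl _), Int.ediv_self hN.ne'] at h1
      rw [show j + 1 + (N : ℤ) = j + N + 1 by ring]
      linarith
    have hall : ∀ j : ℤ, c (j + N) - c j - k * j = c N - c 0 := by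
      intro j
      induction j using Int.induction_on with
      | zero => simp
      | succ n ih => rw [hstep, ih]
      | pred n ih =>
        have := hstep (-(n : ℤ) - 1)
        rw [sub_add_cancel] at this
        rw [← this, ih]
    linarith [hall i]

/-- A vertical shift by `n` adds `n` to the horizontal shift at every step; this shear is the source
of the quadratic growth. -/
theorem IsTQ.iterate_add (hT : IsTQ T) (z : Plane) (m n : ℤ) (j : ℕ) :
    T^[j] (z + ((m : ℝ), (n : ℝ))) = T^[j] z + ((m : ℝ) + j * n, (n : ℝ)) := by
  induction j with
  | zero => simp
  | succ j ih =>
    have h1 := hT.apply_add (T^[j] z) (m + j * n) n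
    push_cast at h1
    rw [Function.iterate_succ_apply', ih, h1, Function.iterate_succ_apply']
    push_cast
    ring_nf

/-- The sequence of first coordinates of the full orbit of a point whose `n`-th image is an integer
translate of it. -/
theorem IsGeneratingPair.exists_orbit_sequence (hT : IsTQ T) (hg : IsGeneratingPair T g h)
    {z : Plane} {n : ℕ} {a b : ℤ} (hz : T^[n] z = z + ((a : ℝ), (b : ℝ))) :
    ∃ x : ℤ → ℝ, (∀ i, g (x i) (x (i + 1)) = h (x (i - 1)) (x i)) ∧
      ∀ i : ℤ, x (i + n) = x i + a + b * i := by
  set E : Equiv.Perm Plane := Equiv.ofBijective T hT.bijective with hE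
  have hEapp : ∀ w, E w = T w := fun w => rfl
  have hsucc : ∀ i : ℤ, (E ^ (i + 1)) z = T ((E ^ i) z) := fun i => by
    rw [add_comm, zpow_add, zpow_one, Equiv.Perm.mul_apply, hEapp]
  have hpow : ∀ m : ℕ, (E ^ (m : ℤ)) z = T^[m] z := fun m => by
    induction m with
    | zero => simp
    | succ m ih => rw [Nat.cast_succ, hsucc, ih, Function.iterate_succ_apply']
  have hgen : ∀ w : Plane, g w.1 (T w).1 = w.2 ∧ h w.1 (T w).1 = (T w).2 := by
    intro w
    have h1 : g w.1 (T w).1 = w.2 := hg.apply_fst w.1 w.2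
    refine ⟨h1, ?_⟩
    have h2 := hg.map_eq w.1 (T w).1
    rw [h1] at h2
    exact (congrArg Prod.snd h2).symm
  have hshift : ∀ i : ℤ, (E ^ (i + n)) z = (E ^ i) z + ((a : ℝ) + b * i, (b : ℝ)) := by
    intro i
    induction i using Int.induction_on with
    | zero =>
      rw [zero_add, hpow, hz]
      simp
    | succ m ih =>
      have h1 := hT.apply_add ((E ^ (m : ℤ)) z) (a + b * m) b
      push_cast at h1 ih ⊢
      rw [add_right_comm, hsucc, ih, h1, hsucc]
      ring_nf
    | pred m ih =>
      apply hT.bijective.1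
      rw [← hsucc, add_right_comm, sub_add_cancel, ih]
      have h1 := hT.apply_add ((E ^ (-(m : ℤ) - 1)) z) (a + b * (-m - 1)) b
      push_cast at h1 ⊢
      rw [h1, ← hsucc, sub_add_cancel]
      ring_nf
  refine ⟨fun i => ((E ^ i) z).1, fun i => ?_, fun i => ?_⟩
  · have h1 := (hgen ((E ^ i) z)).1
    have h2 := (hgen ((E ^ (i - 1)) z)).2
    rw [← hsucc] at h1 h2
    rw [sub_add_cancel] at h2
    rw [h1, h2]
  · simp only [hshift, Prod.fst_add]
    ring

end TwistMap

/-! ### Rotation numbers and periodic orbits on the torus. -/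

namespace TwistMap

variable {T : Plane → Plane} {g h : ℝ → ℝ → ℝ}

/-- The deviation from uniform vertical motion is `n`-periodic in `m`. -/
theorem IsTQ.exists_vertical_bound (hT : IsTQ T) {z : Plane} {n : ℕ} (hn : 0 < n) {a b : ℤ}
    (hz : T^[n] z = z + ((a : ℝ), (b : ℝ))) :
    ∃ M, ∀ m : ℕ, |(T^[m] z).2 - z.2 - m * ((b : ℝ) / n)| ≤ M := by
  have hn' : (n : ℝ) ≠ 0 := by exact_mod_cast hn.ne'
  set y : ℕ → ℝ := fun m => (T^[m] z).2 - z.2 - m * ((b : ℝ) / n) with hy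
  have hper : Function.Periodic y n := fun m => by
    simp only [hy, Function.iterate_add_apply, hz, hT.iterate_add, Prod.snd_add]
    push_cast
    field_simp
    ring
  obtain ⟨M, hM⟩ := ((Set.finite_Iio n).image fun m => |y m|).bddAbove
  refine ⟨M, fun m => ?_⟩
  have h1 := hper.map_mod_nat m
  change |y m| ≤ M
  rw [← h1]
  exact hM ⟨m % n, Nat.mod_lt _ hn, rfl⟩

theorem IsTQ.tendsto_vertical_speed (hT : IsTQ T) {z : Plane} {n : ℕ} (hn : 0 < n) {a b : ℤ}
    (hz : T^[n] z = z + ((a : ℝ), (b : ℝ))) :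
    Tendsto (fun m : ℕ => ((T^[m] z).2 - z.2) / (m : ℝ)) atTop (𝓝 ((b : ℝ) / n)) := by
  obtain ⟨M, hM⟩ := hT.exists_vertical_bound hn hz
  rw [tendsto_iff_norm_sub_tendsto_zero]
  refine squeeze_zero' (Eventually.of_forall fun _ => norm_nonneg _) ?_
    (tendsto_const_div_atTop_nhds_zero_nat M)
  filter_upwards [eventually_gt_atTop 0] with m hm
  have hm' : (0 : ℝ) < m := by exact_mod_cast hm
  rw [Real.norm_eq_abs, div_sub' hm'.ne', abs_div, abs_of_pos hm']
  exact div_le_div_of_nonneg_right (hM m) hm'.le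

theorem IsTQ.tendsto_vertical (hT : IsTQ T) {z : Plane} {n : ℕ} (hn : 0 < n) {a b : ℤ}
    (hb : b ≠ 0) (hz : T^[n] z = z + ((a : ℝ), (b : ℝ))) :
    Tendsto (fun m : ℕ => (T^[m] z).2) atTop atTop ∨
      Tendsto (fun m : ℕ => (T^[m] z).2) atTop atBot := by
  obtain ⟨M, hM⟩ := hT.exists_vertical_bound hn hz
  have hn' : (0 : ℝ) < n := by exact_mod_cast hn
  rcases lt_or_gt_of_ne hb with hneg | hpos
  · right
    have h1 : (b : ℝ) / n < 0 := div_neg_of_neg_of_pos (by exact_mod_cast hneg) hn'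
    refine tendsto_atBot_mono (fun m => ?_) (tendsto_atBot_add_const_left _ (z.2 + M)
      (tendsto_natCast_atTop_atTop.atTop_mul_const_of_neg h1))
    linarith [(abs_le.1 (hM m)).2]
  · left
    have h1 : 0 < (b : ℝ) / n := div_pos (by exact_mod_cast hpos) hn'
    refine tendsto_atTop_mono (fun m => ?_) (tendsto_atTop_add_const_left _ (z.2 - M)
      (tendsto_natCast_atTop_atTop.atTop_mul_const h1))
    linarith [(abs_le.1 (hM m)).1]

theorem toTorus_eq_iff {z w : Plane} :
    toTorus z = toTorus w ↔ ∃ p q : ℤ, z = w + ((p : ℝ), (q : ℝ)) := by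
  constructor
  · intro hzw
    have key : ∀ s t : ℝ, (s : UnitAddCircle) = t → ∃ p : ℤ, s = t + p := by
      intro s t hst
      rw [← sub_eq_zero, ← AddCircle.coe_sub, AddCircle.coe_eq_zero_iff] at hst
      obtain ⟨p, hp⟩ := hst
      refine ⟨p, ?_⟩
      simp at hp
      linarith
    obtain ⟨p, hp⟩ := key _ _ (congrArg Prod.fst hzw)
    obtain ⟨q, hq⟩ := key _ _ (congrArg Prod.snd hzw)
    exact ⟨p, q, Prod.ext hp hq⟩
  · rintro ⟨p, q, rfl⟩
    simp only [toTorus, Prod.fst_add, Prod.snd_add, coe_add_int]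

theorem toTorus_surjective : Function.Surjective toTorus := fun x =>
  ⟨(rep x.1, rep x.2), by simp only [toTorus, coe_rep]⟩

theorem IsTQ.iterate_torusMap (hT : IsTQ T) (z : Plane) (m : ℕ) :
    (torusMap T)^[m] (toTorus z) = toTorus (T^[m] z) :=
  (Function.Semiconj.iterate_right (fun w => (hT.torusMap_toTorus w).symm) m z).symm

/-- The orbit on the torus of a point of the plane. -/
def torusOrbit (T : Plane → Plane) (z : Plane) : Set Torus :=
  Set.range fun m : ℕ => (torusMap T)^[m] (toTorus z)

theorem IsTQ.iterate_orbit_point (hT : IsTQ T) {z : Plane} {n : ℕ} {a b : ℤ}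
    (hz : T^[n] z = z + ((a : ℝ), (b : ℝ))) {m : ℕ} {p q : ℤ} {z' : Plane}
    (hz' : z' = T^[m] z + ((p : ℝ), (q : ℝ))) :
    T^[n] z' = z' + (((a + m * b + n * q : ℤ) : ℝ), (b : ℝ)) := by
  rw [hz', hT.iterate_add, ← Function.iterate_add_apply, add_comm n m,
    Function.iterate_add_apply, hz, hT.iterate_add]
  ext
  · simp only [Prod.fst_add]
    push_cast
    ring
  · simp only [Prod.snd_add]
    ring

theorem IsTQ.isPeriodicOrbit_torusOrbit (hT : IsTQ T) {z : Plane} {n : ℕ} (hn : 0 < n) {a b : ℤ}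
    (hb : b ≠ 0) (hz : T^[n] z = z + ((a : ℝ), (b : ℝ))) :
    IsPeriodicOrbit (torusMap T) (torusOrbit T z) ∧
      HasVerticalRotationNumber T (torusOrbit T z) ((b : ℝ) / n) := by
  refine ⟨⟨toTorus z, ⟨n, hn, ?_⟩, rfl⟩, fun z' hz' => ?_⟩
  · rw [hT.iterate_torusMap, hz, toTorus_eq_iff]
    exact ⟨a, b, rfl⟩
  · obtain ⟨m, hm⟩ := hz'
    simp only [hT.iterate_torusMap] at hm
    obtain ⟨p, q, hpq⟩ := toTorus_eq_iff.1 hm.symm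
    have h1 := hT.iterate_orbit_point hz hpq
    exact ⟨hT.tendsto_vertical hn hb h1, hT.tendsto_vertical_speed hn h1⟩

theorem IsTQ.iterate_mul (hT : IsTQ T) {z : Plane} {n : ℕ} {a b : ℤ}
    (hz : T^[n] z = z + ((a : ℝ), (b : ℝ))) (t : ℕ) :
    ∃ r : ℤ, T^[n * t] z = z + ((r : ℝ), ((t * b : ℤ) : ℝ)) := by
  induction t with
  | zero => exact ⟨0, by simp⟩
  | succ t ih =>
    obtain ⟨r, hr⟩ := ih
    refine ⟨a + (r + n * (t * b)), ?_⟩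
    rw [Nat.mul_succ, add_comm, Function.iterate_add_apply, hr, hT.iterate_add, hz]
    ext
    · simp only [Prod.fst_add]
      push_cast
      ring
    · simp only [Prod.snd_add]
      push_cast
      ring

/-- In lowest terms, two points of the plane with the same displacement lie over the same orbit of
the torus only if they differ by a horizontal integer translation. -/
theorem IsTQ.eq_add_of_mem_torusOrbit (hT : IsTQ T) {z z' : Plane} {n : ℕ} (hn : 0 < n) {a b : ℤ}
    (hcop : IsCoprime (n : ℤ) b) (hz : T^[n] z = z + ((a : ℝ), (b : ℝ)))
    (hz' : T^[n] z' = z' + ((a : ℝ), (b : ℝ))) (hmem : toTorus z' ∈ torusOrbit T z) :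
    ∃ r : ℤ, z' = z + ((r : ℝ), 0) := by
  obtain ⟨m, hm⟩ := hmem
  simp only [hT.iterate_torusMap] at hm
  obtain ⟨p, q, hpq⟩ := toTorus_eq_iff.1 hm.symm
  have h1 := hT.iterate_orbit_point hz hpq
  rw [hz', add_right_inj] at h1
  -- Equal horizontal displacements force `m * b + n * q = 0`. By coprimality `m = n * t`, so `q =
  -- -t * b` cancels the height gained in `m` steps.
  have h2 : a = a + m * b + n * q := Int.cast_injective (α := ℝ) (congrArg Prod.fst h1)
  have h3 : (n : ℤ) ∣ m := by
    refine hcop.dvd_of_dvd_mul_right ⟨-q, ?_⟩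
    linarith
  obtain ⟨t, rfl⟩ : n ∣ m := by exact_mod_cast h3
  obtain ⟨r, hr⟩ := hT.iterate_mul hz t
  have h4 : (t : ℤ) * b + q = 0 := by
    have h5 : (n : ℤ) * (t * b + q) = 0 := by
      push_cast at h2
      linarith
    exact (mul_eq_zero.1 h5).resolve_left (by exact_mod_cast hn.ne')
  refine ⟨r + p, ?_⟩
  have h6 : ((t * b : ℤ) : ℝ) + q = 0 := by exact_mod_cast h4
  rw [hpq, hr]
  ext
  · simp only [Prod.fst_add]
    push_cast
    ring
  · simp only [Prod.snd_add]
    linarith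

/-- Forcing concentrated at the origin. -/
def originForcing (N : ℕ) (k : ℤ) (i : ZMod N) : ℝ := if i = 0 then (k : ℝ) else 0

/-- A cyclic solution of the forced recurrence is an orbit segment of `T`. -/
theorem IsGeneratingPair.iterate_eq {N : ℕ} (hg : IsGeneratingPair T g h) {k : ℤ}
    {u : ZMod N → ℝ} (hu : ∀ i, defect g h (originForcing N k) u i = 0) {j : ℕ} (hj : j < N) :
    T^[j] (u 0, g (u 0) (u 1)) = (u j, g (u j) (u (j + 1))) := by
  induction j with
  | zero => simp
  | succ j ih =>
    rw [Function.iterate_succ_apply', ih (by omega), hg.map_eq]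
    have h1 := hu (j + 1)
    have h2 : ((j : ZMod N) + 1) ≠ 0 := by
      intro h0
      have h3 : ((j + 1 : ℕ) : ZMod N) = 0 := by exact_mod_cast h0
      rw [ZMod.natCast_eq_zero_iff] at h3
      exact absurd (Nat.le_of_dvd (by omega) h3) (by omega)
    simp only [defect, originForcing, if_neg h2, add_zero, add_sub_cancel_right] at h1
    push_cast
    rw [sub_eq_zero.1 h1]

theorem IsGeneratingPair.iterate_period {N : ℕ} [NeZero N] (hg : IsGeneratingPair T g h) {k : ℤ}
    {u : ZMod N → ℝ} (hu : ∀ i, defect g h (originForcing N k) u i = 0) :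
    T^[N] (u 0, g (u 0) (u 1)) = (u 0, g (u 0) (u 1)) + (((0 : ℤ) : ℝ), (k : ℝ)) := by
  obtain ⟨m, rfl⟩ := Nat.exists_eq_succ_of_ne_zero (NeZero.ne N)
  have h1 := hg.iterate_eq hu (j := m) (by omega)
  have h2 : (m : ZMod m.succ) + 1 = 0 := by
    have := ZMod.natCast_self m.succ
    rwa [Nat.cast_succ] at this
  rw [Function.iterate_succ_apply', h1, hg.map_eq, h2]
  -- The forcing enters only when the cycle closes: the height on return is `g (u 0) (u 1) + k`.
  have h3 := hu 0
  simp only [defect, originForcing, if_true, zero_add, zero_sub] at h3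
  rw [eq_neg_of_add_eq_zero_left h2]
  ext
  · simp
  · simp only [Prod.snd_add]
    linarith

/-- An orbit of `T`, shifted by integers, solves the forced recurrence and has quadratic growth. -/
theorem IsGeneratingPair.exists_forced_solution (hT : IsTQ T) (hg : IsGeneratingPair T g h)
    {z : Plane} {n : ℕ} {a b : ℤ} (hz : T^[n] z = z + ((a : ℝ), (b : ℝ))) (N : ℕ) [NeZero N]
    (k : ℤ) : ∃ (w : ℤ → ℝ) (A : ℝ),
      (∀ i : ℤ, g (w i) (w (i + 1)) - h (w (i - 1)) (w i) + originForcing N k i = 0) ∧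
      ∀ i : ℤ, w (i + (N * n : ℕ)) = w i + A + ((N : ℝ) * b - n * k) * i := by
  obtain ⟨x, hx, hxn⟩ := hg.exists_orbit_sequence hT hz
  obtain ⟨c, hc, C, hcN⟩ := exists_second_difference N k
  obtain ⟨A₁, h₁⟩ := exists_add_mul_eq hxn N
  obtain ⟨A₂, h₂⟩ := exists_add_mul_eq (x := fun i => (c i : ℝ)) (n := N) (A := C) (B := k)
    (fun i => by rw [hcN]; push_cast; ring) n
  -- An integer shift by `-c` changes the defect by minus the second difference of `c`, which the
  -- forcing compensates.
  refine ⟨fun i => x i + ((-c i : ℤ) : ℝ), A₁ - A₂, fun i => ?_, fun i => ?_⟩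
  · simp only [hg.left_add_int, hg.right_add_int]
    have h3 : originForcing N k i = ((c (i + 1) - 2 * c i + c (i - 1) : ℤ) : ℝ) := by
      rw [hc, originForcing]
      split_ifs <;> simp
    rw [h3, hx]
    push_cast
    ring
  · have h3 := h₂ i
    rw [mul_comm n N] at h3
    simp only [h₁]
    push_cast at h3 ⊢
    rw [h3]
    ring

/-- Two orbits whose vertical speeds are separated by `k / N`, in lowest terms, force two periodic
orbits of the torus with vertical rotation number `k / N`. -/
theorem IsTQ.exists_two_periodic_orbits (hT : IsTQ T) {N : ℕ} (hN : 0 < N) {k : ℤ} (hk : k ≠ 0)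
    (hcop : IsCoprime (N : ℤ) k)
    {z z' : Plane} {n n' : ℕ} (hn : 0 < n) (hn' : 0 < n') {a b a' b' : ℤ}
    (hz : T^[n] z = z + ((a : ℝ), (b : ℝ))) (hz' : T^[n'] z' = z' + ((a' : ℝ), (b' : ℝ)))
    (hgt : (k : ℝ) / N < b / n) (hlt : (b' : ℝ) / n' < k / N) :
    ∃ O₁ O₂ : Set Torus, O₁ ≠ O₂ ∧
      (IsPeriodicOrbit (torusMap T) O₁ ∧ HasVerticalRotationNumber T O₁ ((k : ℝ) / N)) ∧
      (IsPeriodicOrbit (torusMap T) O₂ ∧ HasVerticalRotationNumber T O₂ ((k : ℝ) / N)) := by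
  have : NeZero N := ⟨hN.ne'⟩
  have hNr : (0 : ℝ) < N := by exact_mod_cast hN
  have hnr : (0 : ℝ) < n := by exact_mod_cast hn
  have hnr' : (0 : ℝ) < n' := by exact_mod_cast hn'
  obtain ⟨g, h, hg⟩ := hT.exists_isGeneratingPair
  obtain ⟨w, A, hw, hwN⟩ := hg.exists_forced_solution hT hz N k
  obtain ⟨w', A', hw', hwN'⟩ := hg.exists_forced_solution hT hz' N k
  rw [div_lt_div_iff₀ hNr hnr] at hgt
  rw [div_lt_div_iff₀ hnr' hNr] at hlt
  obtain ⟨u, v, hu, hv, huv⟩ := hg.exists_two_cyclic_solutions (originForcing N k) hw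
    (tendsto_atTop_of_quadratic_growth (Nat.mul_pos hN hn) (by linarith) hwN) hw'
    (tendsto_atBot_of_quadratic_growth (Nat.mul_pos hN hn') (by linarith) hwN')
  have hup := hg.iterate_period hu
  have hvp := hg.iterate_period hv
  refine ⟨torusOrbit T (u 0, g (u 0) (u 1)), torusOrbit T (v 0, g (v 0) (v 1)), fun heq => ?_,
    hT.isPeriodicOrbit_torusOrbit hN hk hup, hT.isPeriodicOrbit_torusOrbit hN hk hvp⟩
  -- Both starting points have displacement `(0, k)`. If they lie over one orbit, they differ by a
  -- horizontal integer `r`, and then so do the whole configurations.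
  obtain ⟨r, hr⟩ := hT.eq_add_of_mem_torusOrbit hN hcop hup hvp (heq ▸ ⟨0, rfl⟩)
  refine huv r (funext fun i => ?_)
  have h1 := hg.iterate_eq hu (ZMod.val_lt i)
  have h2 := hg.iterate_eq hv (ZMod.val_lt i)
  rw [ZMod.natCast_val, ZMod.cast_id', id_eq] at h1 h2
  have h3 := hT.iterate_add (u 0, g (u 0) (u 1)) r 0 i.val
  simp only [Int.cast_zero, mul_zero, add_zero] at h3
  rw [← hr, h1, h2] at h3
  exact congrArg Prod.fst h3

/-- A periodic orbit of the torus lifts to a point whose iterate is an integer translate, and the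
vertical translation determines the rotation number. -/
theorem IsTQ.exists_lift_of_periodicOrbit (hT : IsTQ T) {O : Set Torus} {ω : ℝ}
    (hO : IsPeriodicOrbit (torusMap T) O) (hω : HasVerticalRotationNumber T O ω) :
    ∃ (z : Plane) (n : ℕ) (a b : ℤ), 0 < n ∧ T^[n] z = z + ((a : ℝ), (b : ℝ)) ∧
      ω = (b : ℝ) / n := by
  obtain ⟨x, ⟨n, hn, hx⟩, rfl⟩ := hO
  obtain ⟨z, rfl⟩ := toTorus_surjective x
  rw [hT.iterate_torusMap] at hx
  obtain ⟨a, b, hab⟩ := toTorus_eq_iff.1 hx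
  exact ⟨z, n, a, b, hn, hab, tendsto_nhds_unique (hω z ⟨0, rfl⟩).2
    (hT.tendsto_vertical_speed hn hab)⟩

end TwistMap

/-! ### The theorem. -/

theorem mainTheorem2 (T : TwistMap.Plane → TwistMap.Plane) (hT : TwistMap.IsTQ T)
    (μ : MeasureTheory.Measure TwistMap.Cylinder)
    (hμ : TwistMap.IsExact μ (TwistMap.cylinderMap T))
    (k : ℤ) (N : ℕ) (hN : 0 < N)
    (hper : ∃ O : Set TwistMap.Torus, TwistMap.IsPeriodicOrbit (TwistMap.torusMap T) O ∧
      TwistMap.HasVerticalRotationNumber T O ((k : ℝ) / (N : ℝ)))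
    (k' : ℤ) (N' : ℕ) (hk' : k' ≠ 0) (hN' : 0 < N')
    (hlt : |(k' : ℝ) / (N' : ℝ)| < |(k : ℝ) / (N : ℝ)|) (hsign : 0 < k * k') :
    ∃ O₁ O₂ : Set TwistMap.Torus, O₁ ≠ O₂ ∧
      (TwistMap.IsPeriodicOrbit (TwistMap.torusMap T) O₁ ∧
        TwistMap.HasVerticalRotationNumber T O₁ ((k' : ℝ) / (N' : ℝ))) ∧
      (TwistMap.IsPeriodicOrbit (TwistMap.torusMap T) O₂ ∧
        TwistMap.HasVerticalRotationNumber T O₂ ((k' : ℝ) / (N' : ℝ))) := by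
  obtain ⟨O, hO, hω⟩ := hper
  obtain ⟨z, n, a, b, hn, hz, hb⟩ := hT.exists_lift_of_periodicOrbit hO hω
  obtain ⟨g, h, hg⟩ := hT.exists_isGeneratingPair
  obtain ⟨s, hs⟩ := hμ.exists_diag_eq hT hg
  have hfix : T^[1] (s, g s s) = (s, g s s) + (((0 : ℤ) : ℝ), ((0 : ℤ) : ℝ)) := by
    rw [Function.iterate_one, hg.map_eq, ← hs]
    simp
  have hNr : (0 : ℝ) < N := by exact_mod_cast hN
  have hNr' : (0 : ℝ) < N' := by exact_mod_cast hN'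
  -- Lowest terms are needed to tell the two orbits apart; the rotation number is unchanged.
  set q : ℚ := (k' : ℚ) / N' with hq
  have hqr : (q.num : ℝ) / q.den = (k' : ℝ) / N' := by
    have h1 : ((q : ℚ) : ℝ) = (k' : ℝ) / N' := by rw [hq]; push_cast; rfl
    rw [← h1]
    conv_rhs => rw [← Rat.num_div_den q]
    push_cast
    rfl
  have hqne : q.num ≠ 0 := by
    rw [Rat.num_ne_zero, hq]
    exact div_ne_zero (by exact_mod_cast hk') (by exact_mod_cast hN'.ne')
  have hcop : IsCoprime (q.den : ℤ) q.num := by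
    rw [Int.isCoprime_iff_gcd_eq_one, Int.gcd_comm]
    exact q.reduced
  rw [← hqr] at hlt ⊢
  rw [hb] at hlt
  -- The target speed lies strictly between that of the fixed point and that of the given orbit; the
  -- sign decides which of the two is the faster.
  rcases pos_and_pos_or_neg_and_neg_of_mul_pos hsign with ⟨hk, hk'⟩ | ⟨hk, hk'⟩
  · have h1 : 0 < (q.num : ℝ) / q.den := by
      rw [hqr]
      exact div_pos (by exact_mod_cast hk') hNr'
    have h2 : 0 < (b : ℝ) / n := by
      rw [← hb]
      exact div_pos (by exact_mod_cast hk) hNr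
    rw [abs_of_pos h1, abs_of_pos h2] at hlt
    exact hT.exists_two_periodic_orbits q.den_pos hqne hcop hn one_pos hz hfix hlt (by simpa using h1)
  · have h1 : (q.num : ℝ) / q.den < 0 := by
      rw [hqr]
      exact div_neg_of_neg_of_pos (by exact_mod_cast hk') hNr'
    have h2 : (b : ℝ) / n < 0 := by
      rw [← hb]
      exact div_neg_of_neg_of_pos (by exact_mod_cast hk) hNr
    rw [abs_of_neg h1, abs_of_neg h2, neg_lt_neg_iff] at hlt
    exact hT.exists_two_periodic_orbits q.den_pos hqne hcop one_pos hn hfix hz (by simpa using h1) hlt
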